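/- **Robustness of SPECS to a misspecified process reward model.** *Setting.* A blockwise policy $\pi$ assigns to each prompt $x$ and each partial trace $y_{\le t}=(y_1,\dots,y_t)$ of blocks a (discrete) distribution $\pi(\cdot\mid x,y_{\le t})$ of the next block; a full response consists of $H$ blocks. Let $\pi_{\mathrm{target}},\pi_{\mathrm{draft}}$ be two blockwise policies, $r(x,y)$ a real reward on full responses and $\beta>0$. Put $$\pi^\star_\beta(y\mid x)\propto\pi_{\mathrm{target}}(y\mid x)\,e^{\beta r(x,y)},\qquad V(x,y_{\le t})=\tfrac1\beta\log\mathbb E_{Y\sim\pi_{\mathrm{target}}(\cdot\mid x,y_{\le t})}\big[e^{\beta r(x,Y)}\big],$$ where $Y$ is a completion of $y_{\le t}$ to a full response and all these expectations are assumed finite. The idealized PRM is $$r^{\mathrm{target}}_{\mathrm{PRM}}(y_t\mid x,y_{\le t-1})=V(x,y_{\le t})-V(x,y_{\le t-1}).$$ The block-level coverage coefficient at the prompt $x$ is $$C_{\mathrm{block}}(x)=\sup_{0\le t<H}\ \sup_{y_{\le t}}\left\|\frac{\pi_{\mathrm{target}}(\cdot\mid x,y_{\le t})}{\pi_{\mathrm{draft}}(\cdot\mid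 x,y_{\le t})}\right\|_\infty\left\|\frac{\pi_{\mathrm{draft}}(\cdot\mid x,y_{\le t})}{\pi_{\mathrm{target}}(\cdot\mid x,y_{\le t})}\right\|_\infty\in[0,\infty].$$ *Algorithm.* SPECS, run with a PRM $r_{\mathrm{PRM}}(y_t\mid x,y_{\le t-1})$, a threshold $\tau\in\mathbb R$ and beam-width $n$, starts from the empty trace with generator $\pi_{\mathrm{gen}}=\pi_{\mathrm{target}}$ and performs $H$ iterations. With current trace $\mathrm{tr}$, an iteration draws $N$ i.i.d. candidate blocks $Y_1,\dots,Y_N\sim\pi_{\mathrm{gen}}(\cdot\mid x,\mathrm{tr})$, appends to the trace the block $Y_{i^\star}$ where $i^\star=i$ with probability proportional to $\frac{\pi_{\mathrm{target}}(Y_i\mid x,\mathrm{tr})}{\pi_{\mathrm{gen}}(Y_i\mid x,\mathrm{tr})}e^{\beta r_{\mathrm{PRM}}(Y_i\mid x,\mathrm{tr})}$, and then, if $\max_i r_{\mathrm{PRM}}(Y_i\mid x,\mathrm{tr})>\tau$ (with $\mathrm{tr}$ the trace before appending), sets $\pi_{\mathrm{gen}}=\pi_{\mathrm{draft}}$ for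 all later iterations. Either $N=n$ in every iteration, or $N$ is drawn afresh in each iteration from the Poisson distribution of mean $n$ conditioned to be positive. Let $\pi_{\mathrm{SPECS}}(\cdot\mid x)$ be the law of the returned response. *Theorem.* There are absolute constants $C>0$ and $k\in\mathbb N$ such that the following holds, in all settings as above and for both choices of $N$. Let $n\ge3$, $\tau\in\mathbb R$ and $\varepsilon_{\mathrm{PRM}}\ge0$, and suppose that $\|r_{\mathrm{PRM}}-r^{\mathrm{target}}_{\mathrm{PRM}}\|_\infty\le\varepsilon_{\mathrm{PRM}}$ and that $r_{\mathrm{PRM}}$ has a range of length $R$, i.e. for all $x$ and $y_{\le t-1}$, $t\le H$, there is $a\in\mathbb R$ with $r_{\mathrm{PRM}}(\cdot\mid x,y_{\le t-1})\in[a,a+R]$ (for instance $r_{\mathrm{PRM}}\in[0,R]$). Then for every prompt $x$ $$D_{\mathrm{KL}}\big(\pi_{\mathrm{SPECS}}(\cdot\mid x)\,\big\|\,\pi^\star_\beta(\cdot\mid x)\big)\le C\log^k(n)\left(H\,C_{\mathrm{block}}(x)^2\,\frac{e^{2\beta R}}{n^{3/2}}+\beta H\varepsilon_{\mathrm{PRM}}\right),$$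 and, for every distribution $\rho$ of prompts, $\mathbb E_{x\sim\rho}\big[D_{\mathrm{KL}}(\pi_{\mathrm{SPECS}}(\cdot\mid x)\|\pi^\star_\beta(\cdot\mid x))\big]$ is at most the same bound with $C_{\mathrm{block}}=\sup_xC_{\mathrm{block}}(x)$. -/

import Mathlib

open MeasureTheory ProbabilityTheory InformationTheory
open scoped ENNReal NNReal

noncomputable section

namespace SPECS

/-- A blockwise (autoregressive) policy: for a prompt in `X` and a partial trace, which is a list of
blocks in `B` in chronological order, the distribution of the next block. -/
abbrev Policy (X B : Type*) := X → List B → PMF B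

/-- The measure of a discrete distribution, on the discrete sigma-algebra. -/
def law {α : Type*} (p : PMF α) : @Measure α ⊤ := @PMF.toMeasure α ⊤ p

/-- The law of `k` independent draws from `p`. -/
def iid {α : Type*} (p : PMF α) : (k : ℕ) → PMF (Fin k → α)
  | 0 => PMF.pure Fin.elim0
  | k + 1 => p.bind fun a => (iid p k).map fun v => Fin.cons a v

/-- The law of the trace obtained from the partial trace `s` by generating `k` more blocks. -/
def complete {X B : Type*} (π : Policy X B) (x : X) : ℕ → List B → PMF (List B)
  | 0, s => PMF.pure s
  | k + 1, s => (π x s).bind fun b => complete π x k (s ++ [b])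

/-- The law, on the full responses (traces of `H` blocks), of the policy `π` at the prompt `x`. -/
def responseLaw {X B : Type*} (π : Policy X B) (H : ℕ) (x : X) : PMF (List B) :=
  complete π x H []

/-- The optimal policy `π⋆_β(y | x) ∝ π_target(y | x) exp(β r(x, y))` on full responses. -/
def optimalPolicy {X B : Type*} (target : Policy X B) (r : X → List B → ℝ) (β : ℝ) (H : ℕ)
    (x : X) : @Measure (List B) ⊤ :=
  (law (responseLaw target H x)).tilted fun y => β * r x y

/-- The optimal KL-regularized value
`V^π_β(x, s) = β⁻¹ log 𝔼[exp(β r(x, Y))]`, `Y` a completion by `π` of the partial trace `s`. -/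
def value {X B : Type*} (π : Policy X B) (r : X → List B → ℝ) (β : ℝ) (H : ℕ)
    (x : X) (s : List B) : ℝ :=
  1 / β * Real.log (∫ y, Real.exp (β * r x y) ∂(law (complete π x (H - s.length) s)))

/-- The idealized process reward model: the KL-regularized advantage of the block `b` after `s`. -/
def idealPRM {X B : Type*} (π : Policy X B) (r : X → List B → ℝ) (β : ℝ) (H : ℕ)
    (x : X) (s : List B) (b : B) : ℝ :=
  value π r β H x (s ++ [b]) - value π r β H x s

/-- The exponentiated score `exp(S)`, `S = log(π_target(b) / π_gen(b)) + β r(b)`; it is `0` when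
`π_target(b) = 0`. -/
def expScore {B : Type*} (target gen : PMF B) (β : ℝ) (r : B → ℝ) (b : B) : ℝ≥0∞ :=
  target b / gen b * ENNReal.ofReal (Real.exp (β * r b))

open scoped Classical in
/-- `SubSample`: an index is drawn with probability proportional to its exponentiated score `w i`.
(If every candidate has exponentiated score `0`, the index is drawn uniformly; as long as the target
and generator distributions have bounded density ratios this has probability zero.) -/
def subSample {N : ℕ} [NeZero N] (w : Fin N → ℝ≥0∞) : PMF (Fin N) :=
  if h : (∑' i, w i) ≠ 0 ∧ (∑' i, w i) ≠ ⊤ then PMF.normalize w h.1 h.2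
  else PMF.uniformOfFintype (Fin N)

open scoped Classical in
/-- One iteration of SPECS. The state is the current trace together with a flag telling whether the
draft generator has been switched to the draft model. The beam-width `N` is drawn from `ν`, then `N`
candidate blocks are drawn independently from the current generator, one of them is selected by
`SubSample`, and the generator is switched to the draft model if some candidate has reward above the
threshold `τ`. -/
def step {X B : Type*} (target draft : Policy X B) (rPRM : X → List B → B → ℝ) (β τ : ℝ)
    (ν : PMF ℕ+) (x : X) (st : List B × Bool) : PMF (List B × Bool) :=
  let gen : PMF B := if st.2 = true then draft x st.1 else target x st.1
  ν.bind fun N => (iid gen N).bind fun Y =>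
    (subSample fun i => expScore (target x st.1) gen β (rPRM x st.1) (Y i)).map fun i =>
      (st.1 ++ [Y i], st.2 || decide (∃ j, τ < rPRM x st.1 (Y j)))

/-- The state of SPECS after a number of iterations: it starts from the empty trace, with the target
model as generator. -/
def run {X B : Type*} (target draft : Policy X B) (rPRM : X → List B → B → ℝ) (β τ : ℝ)
    (ν : PMF ℕ+) (x : X) : ℕ → PMF (List B × Bool)
  | 0 => PMF.pure ([], false)
  | k + 1 => (run target draft rPRM β τ ν x k).bind (step target draft rPRM β τ ν x)

/-- `π_SPECS(· | x)`: the law of the trace returned by SPECS after `H` blocks. -/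
def specsPolicy {X B : Type*} (target draft : Policy X B) (rPRM : X → List B → B → ℝ) (β τ : ℝ)
    (ν : PMF ℕ+) (H : ℕ) (x : X) : PMF (List B) :=
  (run target draft rPRM β τ ν x H).map Prod.fst

/-- `sup_b p(b) / q(b)`, with `0 / 0 = 0` and `a / 0 = ∞` for `a > 0`. -/
def ratioSup {B : Type*} (p q : PMF B) : ℝ≥0∞ := ⨆ b, p b / q b

/-- The block-level coverage coefficient `C_block` at the prompt `x`. -/
def coverage {X B : Type*} (target draft : Policy X B) (H : ℕ) (x : X) : ℝ≥0∞ :=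
  ⨆ (s : List B) (_ : s.length < H),
    ratioSup (target x s) (draft x s) * ratioSup (draft x s) (target x s)

theorem poisson_tsum_ne_zero (n : ℕ+) :
    (∑' k : ℕ+, poissonMeasure ((n : ℕ) : ℝ≥0) {(k : ℕ)}) ≠ 0 := by
  intro h
  have h1 := ENNReal.tsum_eq_zero.1 h 1
  rw [poissonMeasure_singleton, ENNReal.ofReal_eq_zero] at h1
  have hn : (0 : ℝ) < ((n : ℕ) : ℝ) := by exact_mod_cast n.pos
  have : (0 : ℝ) < Real.exp (-((n : ℕ) : ℝ)) * ((n : ℕ) : ℝ) := mul_pos (Real.exp_pos _) hn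
  simp at h1
  linarith

theorem poisson_tsum_ne_top (n : ℕ+) :
    (∑' k : ℕ+, poissonMeasure ((n : ℕ) : ℝ≥0) {(k : ℕ)}) ≠ ⊤ := by
  rw [← measure_iUnion (fun i j hij => by simpa using hij) (fun _ => measurableSet_singleton _)]
  exact measure_ne_top _ _

/-- The law `Poi(n)|_{>0}`: Poisson with mean `n`, conditioned on being positive. -/
def positivePoisson (n : ℕ+) : PMF ℕ+ :=
  PMF.normalize (fun k : ℕ+ => poissonMeasure ((n : ℕ) : ℝ≥0) {(k : ℕ)})
    (poisson_tsum_ne_zero n) (poisson_tsum_ne_top n)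

/-- `H · c² · exp(2βR) / n^{3/2} + β H ε`, where `c` is a coverage coefficient. -/
def errorRate (H : ℕ) (β R ε : ℝ) (n : ℕ+) (c : ℝ≥0∞) : ℝ≥0∞ :=
  (H : ℝ≥0∞) * c ^ 2 * ENNReal.ofReal (Real.exp (2 * β * R) / ((n : ℕ) : ℝ) ^ (3 / 2 : ℝ))
    + ENNReal.ofReal (β * H * ε)

end SPECS

end

/-! ### Discrete laws, their Kullback-Leibler divergence and its chain rule -/

namespace SPECS

variable {α β B : Type*}

/-! The optimal policy is itself blockwise. Let `moment` at `s` be `E[exp(β r)]` over completions of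
`s` by the target. Averaging it over one target block reproduces it, so `π_target(b) * moment (s ++
[b]) / moment s = π_target(b) * exp(β * idealPRM)` is a probability in `b`, and these conditionals
`S` multiply up to the optimal law (`exists_optimal_step`, `optimalPolicy_eq_law`). By the chain
rule `pmfKL_snoc`, the divergence is then a sum of `H` conditional divergences against `S`.

One iteration is self-normalized importance sampling. The weights cancel the generator, so target
and draft generators aim at the same `Q ∝ π_target * exp(β * rPRM)`. With `N` candidates the output
density equals that of `Q` up to a factor `1 ± 3κ/N`, uniformly over blocks, where `κ ≤ C_block *
exp(βR)` bounds the ratio of weights (`near_select`). Such closeness survives mixtures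
(`Near.bind`), so a random `N` costs only `E[1/N] ≤ 2/n`, and the switching rule enters only through
a mixture over the flag given the trace.

A uniform relative error `η` costs only `η ^ 2` in divergence, since `klFun v ≤ (v - 1) ^ 2`.
Passing from `Q` to `S` costs `log sup (Q / S) ≤ 2βε` (`exists_tilt`, `pmfKL_le_of_near`). The total
is `H * (36 κ² / n² + 2βε)`, which implies the stated rate without any logarithm. -/

theorem tsum_bind_mul (p : PMF α) (f : α → PMF β) (F : β → ℝ≥0∞) :
    ∑' b, (p.bind f) b * F b = ∑' a, p a * ∑' b, f a b * F b := by
  simp_rw [PMF.bind_apply, ← ENNReal.tsum_mul_right, ← ENNReal.tsum_mul_left, mul_assoc]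
  exact ENNReal.tsum_comm

theorem tsum_pure_mul (a : α) (F : α → ℝ≥0∞) : ∑' b, (PMF.pure a) b * F b = F a := by
  rw [tsum_eq_single a fun b hb => by simp [PMF.pure_apply, hb]]
  simp

theorem tsum_map_mul (p : PMF α) (g : α → β) (F : β → ℝ≥0∞) :
    ∑' b, (p.map g) b * F b = ∑' a, p a * F (g a) := by
  simp_rw [PMF.map, tsum_bind_mul, Function.comp, tsum_pure_mul]

theorem law_apply (p : PMF α) (s : Set α) : law p s = ∑' a, s.indicator p a :=
  @PMF.toMeasure_apply α ⊤ p s trivial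

instance isProbabilityMeasure_law (p : PMF α) : IsProbabilityMeasure (law p) :=
  @PMF.toMeasure.isProbabilityMeasure α ⊤ p

theorem law_eq_sum (p : PMF α) :
    law p = Measure.sum fun a => p a • @Measure.dirac α ⊤ a := by
  let _ : MeasurableSpace α := ⊤
  refine Measure.ext fun s hs => ?_
  rw [law_apply, Measure.sum_apply _ hs]
  refine tsum_congr fun a => ?_
  rw [Measure.smul_apply, Measure.dirac_apply' _ hs]
  by_cases h : a ∈ s <;> simp [h]

theorem lintegral_law (p : PMF α) (F : α → ℝ≥0∞) : ∫⁻ a, F a ∂(law p) = ∑' a, p a * F a := by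
  let _ : MeasurableSpace α := ⊤
  rw [law_eq_sum, lintegral_sum_measure]
  refine tsum_congr fun a => ?_
  rw [lintegral_smul_measure, lintegral_dirac' _ measurable_from_top, smul_eq_mul]

theorem law_eq_withDensity {p q : PMF α} {g : α → ℝ≥0∞} (h : ∀ a, p a = q a * g a) :
    law p = (law q).withDensity g := by
  let _ : MeasurableSpace α := ⊤
  refine Measure.ext fun s hs => ?_
  rw [withDensity_apply _ hs, ← lintegral_indicator hs, lintegral_law, law_apply]
  refine tsum_congr fun a => ?_
  by_cases ha : a ∈ s <;> simp [ha, h]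

/-- The Kullback-Leibler divergence of two discrete distributions, the first of which is absolutely
continuous with respect to the second. -/
noncomputable def pmfKL (p q : PMF α) : ℝ≥0∞ :=
  ∑' a, q a * ENNReal.ofReal (klFun ((p a).toReal / (q a).toReal))

theorem klDiv_law {p q : PMF α} (h : ∀ a, q a = 0 → p a = 0) :
    klDiv (law p) (law q) = pmfKL p q := by
  let _ : MeasurableSpace α := ⊤
  have hd : law p = (law q).withDensity fun a => p a / q a := by
    refine law_eq_withDensity fun a => ?_
    exact (ENNReal.mul_div_cancel' (fun h0 => h a h0) fun ht => absurd ht (q.apply_ne_top a)).symm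
  have hac : law p ≪ law q := hd ▸ withDensity_absolutelyContinuous _ _
  have hr : (law p).rnDeriv (law q) =ᵐ[law q] fun a => p a / q a := by
    rw [hd]
    exact Measure.rnDeriv_withDensity _ measurable_from_top
  rw [klDiv_eq_lintegral_klFun_of_ac hac, pmfKL, ← lintegral_law]
  refine lintegral_congr_ae ?_
  filter_upwards [hr] with a ha
  rw [ha, ENNReal.toReal_div]

/-- This is `log (u * v) = log u + log v`, with the linear terms placed so that both sides are sums
of nonnegative terms when `u, v ≥ 0` and the identity passes to `ℝ≥0∞`. -/
theorem klFun_mul_add (u v : ℝ) :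
    klFun (u * v) + (u + v) = v * klFun u + u * klFun v + (1 + u * v) := by
  rcases eq_or_ne u 0 with rfl | hu
  · simp [klFun, add_comm]
  rcases eq_or_ne v 0 with rfl | hv
  · simp [klFun, add_comm]
  simp only [klFun, Real.log_mul hu hv]
  ring

theorem klFun_le_sq {v : ℝ} (hv : 0 ≤ v) : klFun v ≤ (v - 1) ^ 2 := by
  rcases hv.eq_or_lt with rfl | hv
  · simp [klFun]
  have := mul_le_mul_of_nonneg_left (Real.log_le_sub_one_of_pos hv) hv.le
  simp only [klFun]
  nlinarith

/-- Meant for `v = K / Q` and `h = Q / S`: the logarithm of `v * h` splits and `log h ≤ γ`. -/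
theorem klFun_mul_add_le {v h γ : ℝ} (hv : 0 ≤ v) (h0 : 0 ≤ h) (hγ : h ≤ Real.exp γ) :
    klFun (v * h) + h ≤ h * klFun v + (γ * (v * h) + 1) := by
  rcases h0.eq_or_lt with rfl | h0
  · simp [klFun]
  rcases hv.eq_or_lt with rfl | hv
  · simp [klFun, add_comm]
  have hl : Real.log h ≤ γ := (Real.log_le_iff_le_exp h0).2 hγ
  have := mul_le_mul_of_nonneg_right hl (mul_pos hv h0).le
  simp only [klFun, Real.log_mul hv.ne' h0.ne']
  nlinarith

theorem mul_ofReal_div {p q : PMF α} {a : α} (h : q a = 0 → p a = 0) :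
    q a * ENNReal.ofReal ((p a).toReal / (q a).toReal) = p a := by
  rw [← ENNReal.toReal_div, ENNReal.ofReal_toReal]
  · exact ENNReal.mul_div_cancel' h fun ht => absurd ht (q.apply_ne_top a)
  · rcases eq_or_ne (q a) 0 with h0 | h0
    · simp [h h0]
    · exact ENNReal.div_ne_top (p.apply_ne_top a) h0

/-- The contribution of one fibre to the chain rule for the Kullback-Leibler divergence. -/
theorem tsum_klFun_mul {K S : PMF B} {u : ℝ} (hu : 0 ≤ u) (h : u ≠ 0 → ∀ b, S b = 0 → K b = 0) :
    ∑' b, S b * ENNReal.ofReal (klFun (u * ((K b).toReal / (S b).toReal))) =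
      ENNReal.ofReal (klFun u) + ENNReal.ofReal u * pmfKL K S := by
  rcases hu.eq_or_lt with rfl | hu'
  · simp [ENNReal.tsum_mul_right, S.tsum_coe]
  have h := h hu'.ne'
  have hK : ∑' b, S b * ENNReal.ofReal ((K b).toReal / (S b).toReal) = 1 := by
    simp_rw [fun b => mul_ofReal_div (h b), K.tsum_coe]
  -- `klFun_mul_add` integrated against `S`; the linear terms sum to `1 + u` on both sides and
  -- cancel.
  have key : ∀ b, S b * ENNReal.ofReal (klFun (u * ((K b).toReal / (S b).toReal))) +
      (S b * ENNReal.ofReal u + S b * ENNReal.ofReal ((K b).toReal / (S b).toReal)) =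
      S b * ENNReal.ofReal ((K b).toReal / (S b).toReal) * ENNReal.ofReal (klFun u) +
      ENNReal.ofReal u * (S b * ENNReal.ofReal (klFun ((K b).toReal / (S b).toReal))) +
      (S b + ENNReal.ofReal u * (S b * ENNReal.ofReal ((K b).toReal / (S b).toReal))) := by
    intro b
    have hv : 0 ≤ (K b).toReal / (S b).toReal := by positivity
    generalize (K b).toReal / (S b).toReal = v at hv
    have e := congrArg ENNReal.ofReal (klFun_mul_add u v)
    have h1 := klFun_nonneg hu
    have h2 := klFun_nonneg hv
    rw [ENNReal.ofReal_add (klFun_nonneg (by positivity)) (by positivity),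
      ENNReal.ofReal_add hu hv, ENNReal.ofReal_add (by positivity) (by positivity),
      ENNReal.ofReal_add (by positivity) (by positivity), ENNReal.ofReal_mul hv,
      ENNReal.ofReal_mul hu, ENNReal.ofReal_add zero_le_one (by positivity),
      ENNReal.ofReal_mul hu, ENNReal.ofReal_one] at e
    calc _ = S b * (ENNReal.ofReal (klFun (u * v)) + (ENNReal.ofReal u + ENNReal.ofReal v)) := by
          ring
      _ = _ := by rw [e]; ring
  have e := tsum_congr (L := .unconditional _) key
  simp_rw [ENNReal.tsum_add, ENNReal.tsum_mul_left, ENNReal.tsum_mul_right] at e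
  rw [hK, S.tsum_coe, one_mul, one_mul, mul_one, add_comm 1 (ENNReal.ofReal u)] at e
  exact (ENNReal.add_left_inj (by simp)).1 e

/-- The law of a trace from `p` extended by a block from the conditional distribution `K`. -/
noncomputable def snoc (p : PMF (List B)) (K : List B → PMF B) : PMF (List B) :=
  p.bind fun s => (K s).map fun b => s ++ [b]

theorem snoc_nil (p : PMF (List B)) (K : List B → PMF B) : snoc p K [] = 0 := by
  simp [snoc, PMF.bind_apply, PMF.map_apply]

theorem snoc_append (p : PMF (List B)) (K : List B → PMF B) (s : List B) (b : B) :
    snoc p K (s ++ [b]) = p s * K s b := by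
  rw [snoc, PMF.bind_apply, tsum_eq_single s, PMF.map_apply, tsum_eq_single b]
  · simp
  · intro c hc
    simp [hc.symm]
  · intro t ht
    rw [mul_eq_zero, PMF.map_apply]
    right
    refine ENNReal.tsum_eq_zero.2 fun c => ?_
    rw [if_neg]
    intro h
    exact ht (List.append_inj_left' h rfl).symm

theorem tsum_list_append (F : List B → ℝ≥0∞) (h : F [] = 0) :
    ∑' y, F y = ∑' s : List B, ∑' b : B, F (s ++ [b]) := by
  rw [← ENNReal.tsum_prod]
  refine (Function.Injective.tsum_eq (g := fun x : List B × B => x.1 ++ [x.2]) ?_ ?_).symm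
  · rintro ⟨s, b⟩ ⟨t, c⟩ h
    simpa using h
  · intro y hy
    rcases List.eq_nil_or_concat y with rfl | ⟨s, b, rfl⟩
    · exact absurd h hy
    · exact ⟨(s, b), by simp⟩

/-- The chain rule for the Kullback-Leibler divergence. -/
theorem pmfKL_snoc {p q : PMF (List B)} {K S : List B → PMF B} (h : ∀ s, q s = 0 → p s = 0)
    (hK : ∀ s, p s ≠ 0 → ∀ b, S s b = 0 → K s b = 0) :
    pmfKL (snoc p K) (snoc q S) = pmfKL p q + ∑' s, p s * pmfKL (K s) (S s) := by
  rw [pmfKL, tsum_list_append _ (by simp [snoc_nil]), pmfKL, ← ENNReal.tsum_add]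
  refine tsum_congr fun s => ?_
  simp_rw [snoc_append, ENNReal.toReal_mul, mul_div_mul_comm, mul_assoc, ENNReal.tsum_mul_left]
  rw [tsum_klFun_mul (by positivity), mul_add, ← mul_assoc, mul_ofReal_div (h s)]
  intro hu
  refine hK s fun h0 => hu (by simp [h0])

/-- The two densities differ by at most a factor `1 ± η`. -/
def Near (η : ℝ≥0∞) (K Q : PMF B) : Prop :=
  ∀ b, K b ≤ Q b + η * Q b ∧ Q b ≤ K b + η * Q b

theorem Near.mono {η θ : ℝ≥0∞} {K Q : PMF B} (h : Near η K Q) (hη : η ≤ θ) : Near θ K Q :=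
  fun b => ⟨(h b).1.trans (by gcongr), (h b).2.trans (by gcongr)⟩

/-- Both inequalities are affine in `K` and measure the error against the fixed `Q`, so averaging
`K` averages `η`. -/
theorem Near.bind {Q : PMF B} (ν : PMF α) {η : α → ℝ≥0∞} {K : α → PMF B}
    (h : ∀ i, Near (η i) (K i) Q) : Near (∑' i, ν i * η i) (ν.bind K) Q := by
  intro b
  have hQ : ∑' i, ν i * Q b = Q b := by rw [ENNReal.tsum_mul_right, ν.tsum_coe, one_mul]
  have hη : ∑' i, ν i * (η i * Q b) = (∑' i, ν i * η i) * Q b := by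
    rw [← ENNReal.tsum_mul_right]
    simp_rw [mul_assoc]
  constructor
  · calc (ν.bind K) b ≤ ∑' i, (ν i * Q b + ν i * (η i * Q b)) := by
          rw [PMF.bind_apply]
          refine ENNReal.tsum_le_tsum fun i => ?_
          rw [← mul_add]
          gcongr
          exact (h i b).1
      _ = _ := by rw [ENNReal.tsum_add, hQ, hη]
  · calc Q b = ∑' i, ν i * Q b := hQ.symm
      _ ≤ ∑' i, (ν i * K i b + ν i * (η i * Q b)) := by
          refine ENNReal.tsum_le_tsum fun i => ?_
          rw [← mul_add]
          gcongr
          exact (h i b).2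
      _ = _ := by rw [ENNReal.tsum_add, hη, PMF.bind_apply]

theorem Near.apply_eq_zero {η : ℝ≥0∞} {K Q : PMF B} (h : Near η K Q) {b : B} (hb : Q b = 0) :
    K b = 0 := by
  simpa [hb] using (h b).1

theorem Near.klFun_le {η : ℝ} (hη : 0 ≤ η) {K Q : PMF B} (h : Near (ENNReal.ofReal η) K Q) {b : B}
    (hb : Q b ≠ 0) : klFun ((K b).toReal / (Q b).toReal) ≤ η ^ 2 := by
  have hq : 0 < (Q b).toReal := ENNReal.toReal_pos hb (Q.apply_ne_top b)
  have hQ := Q.apply_ne_top b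
  have hK := K.apply_ne_top b
  have hm : ENNReal.ofReal η * Q b ≠ ⊤ := ENNReal.mul_ne_top ENNReal.ofReal_ne_top hQ
  have h1 := ENNReal.toReal_mono (by simp [hQ, hm]) (h b).1
  have h2 := ENNReal.toReal_mono (by simp [hK, hm]) (h b).2
  rw [ENNReal.toReal_add (by assumption) hm, ENNReal.toReal_mul, ENNReal.toReal_ofReal hη] at h1 h2
  refine (klFun_le_sq (by positivity)).trans (sq_le_sq' ?_ ?_)
  · rw [neg_le_sub_iff_le_add, ← div_self hq.ne', ← sub_le_iff_le_add, sub_le_iff_le_add,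
      div_add' _ _ _ hq.ne']
    gcongr
  · rw [sub_le_iff_le_add, div_le_iff₀ hq]
    linarith

/-- Factor `K / S = (K / Q) * (Q / S)`. The first factor contributes quadratically, the second
through its logarithm, averaged under `K`. -/
theorem pmfKL_le_of_near {K Q S : PMF B} {η γ : ℝ} (hη : 0 ≤ η) (hγ : 0 ≤ γ)
    (hK : Near (ENNReal.ofReal η) K Q)
    (hQ : ∀ b, Q b ≤ ENNReal.ofReal (Real.exp γ) * S b) :
    pmfKL K S ≤ ENNReal.ofReal (η ^ 2 + γ) := by
  have hQS : ∀ b, S b = 0 → Q b = 0 := fun b hb => by simpa [hb] using hQ b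
  -- The extra terms `Q b` and `S b` replace a subtraction in `ℝ≥0∞`; each has total mass one.
  have key : ∀ b, S b * ENNReal.ofReal (klFun ((K b).toReal / (S b).toReal)) + Q b ≤
      Q b * ENNReal.ofReal (η ^ 2) + (ENNReal.ofReal γ * K b + S b) := by
    intro b
    rcases eq_or_ne (Q b) 0 with hb | hb
    · simp [hb, hK.apply_eq_zero hb, klFun_zero]
    have hS : S b ≠ 0 := fun h0 => hb (hQS b h0)
    have hq : 0 < (Q b).toReal := ENNReal.toReal_pos hb (Q.apply_ne_top b)
    have hs : 0 < (S b).toReal := ENNReal.toReal_pos hS (S.apply_ne_top b)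
    have hle : (Q b).toReal / (S b).toReal ≤ Real.exp γ := by
      rw [div_le_iff₀ hs]
      have := ENNReal.toReal_mono (ENNReal.mul_ne_top ENNReal.ofReal_ne_top (S.apply_ne_top b))
        (hQ b)
      rwa [ENNReal.toReal_mul, ENNReal.toReal_ofReal (Real.exp_nonneg _)] at this
    have e := klFun_mul_add_le (v := (K b).toReal / (Q b).toReal) (by positivity) (by positivity)
      hle
    rw [div_mul_div_cancel₀ hq.ne'] at e
    have e2 := hK.klFun_le hη hb
    have hk : 0 ≤ klFun ((K b).toReal / (S b).toReal) := klFun_nonneg (by positivity)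
    have e3 : (S b).toReal * klFun ((K b).toReal / (S b).toReal) + (Q b).toReal ≤
        (Q b).toReal * η ^ 2 + (γ * (K b).toReal + (S b).toReal) := by
      have e4 := mul_le_mul_of_nonneg_left e hs.le
      have e5 : (S b).toReal * ((Q b).toReal / (S b).toReal) = (Q b).toReal := by field_simp
      have e6 : (S b).toReal * ((K b).toReal / (S b).toReal) = (K b).toReal := by field_simp
      have e7 := mul_le_mul_of_nonneg_left e2 hq.le
      calc _ = (S b).toReal * (klFun ((K b).toReal / (S b).toReal) +
            (Q b).toReal / (S b).toReal) := by rw [mul_add, e5]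
        _ ≤ _ := e4
        _ = (Q b).toReal * klFun ((K b).toReal / (Q b).toReal) +
            (γ * (K b).toReal + (S b).toReal) := by
          linear_combination (klFun ((K b).toReal / (Q b).toReal)) * e5 + γ * e6
        _ ≤ _ := by linarith
    have e4 := ENNReal.ofReal_le_ofReal e3
    rw [ENNReal.ofReal_add (by positivity) (by positivity),
      ENNReal.ofReal_add (by positivity) (by positivity),
      ENNReal.ofReal_add (by positivity) (by positivity), ENNReal.ofReal_mul (by positivity),
      ENNReal.ofReal_mul (by positivity), ENNReal.ofReal_mul (by positivity),
      ENNReal.ofReal_toReal (Q.apply_ne_top b), ENNReal.ofReal_toReal (S.apply_ne_top b),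
      ENNReal.ofReal_toReal (K.apply_ne_top b)] at e4
    exact e4
  have e := ENNReal.tsum_le_tsum key
  simp_rw [ENNReal.tsum_add, ENNReal.tsum_mul_left, ENNReal.tsum_mul_right] at e
  rw [Q.tsum_coe, K.tsum_coe, S.tsum_coe, one_mul, mul_one, ← add_assoc] at e
  rw [ENNReal.ofReal_add (by positivity) hγ]
  exact (ENNReal.add_le_add_iff_right ENNReal.one_ne_top).1 e

end SPECS
-- Moments of i.i.d. sums and the law of the selected block
namespace SPECS

variable {α B : Type*}

/-- The quadratic majorants used later have coefficients of both signs, so their means are computed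
in `ℝ` and brought back here; signs matter only on the support. -/
theorem tsum_mul_ofReal {p : PMF α} {f : α → ℝ} {v : ℝ}
    (hf : HasSum (fun a => (p a).toReal * f a) v) (h0 : ∀ a, p a ≠ 0 → 0 ≤ f a) :
    ∑' a, p a * ENNReal.ofReal (f a) = ENNReal.ofReal v := by
  rw [← hf.tsum_eq, ENNReal.ofReal_tsum_of_nonneg _ hf.summable]
  · refine tsum_congr fun a => ?_
    rw [ENNReal.ofReal_mul ENNReal.toReal_nonneg, ENNReal.ofReal_toReal (p.apply_ne_top a)]
  · intro a
    rcases eq_or_ne (p a) 0 with h | h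
    · simp [h]
    · exact mul_nonneg ENNReal.toReal_nonneg (h0 a h)

theorem hasSum_toReal_mul {p : PMF α} {F : α → ℝ≥0∞} {f : α → ℝ} {v : ℝ≥0∞}
    (hv : ∑' a, p a * F a = v) (hv' : v ≠ ⊤) (hf : ∀ a, p a ≠ 0 → (F a).toReal = f a) :
    HasSum (fun a => (p a).toReal * f a) v.toReal := by
  have h := ENNReal.hasSum_toReal (f := fun a => p a * F a) (hv ▸ hv')
  rw [← ENNReal.tsum_toReal_eq (f := fun a => p a * F a)
    fun a => ENNReal.ne_top_of_tsum_ne_top (hv ▸ hv') a, hv] at h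
  have e : (fun a => (p a).toReal * f a) = fun a => (p a * F a).toReal := funext fun a => ?_
  · rwa [e]
  rcases eq_or_ne (p a) 0 with h0 | h0
  · simp [h0]
  · simp [hf a h0]

theorem iid_apply (p : PMF B) : ∀ (k : ℕ) (Y : Fin k → B), iid p k Y = ∏ i, p (Y i)
  | 0, Y => by simp [iid, Subsingleton.elim Y Fin.elim0]
  | k + 1, Y => by
    rw [iid, PMF.bind_apply, tsum_eq_single (Y 0), PMF.map_apply, tsum_eq_single (Fin.tail Y),
      if_pos (Fin.cons_self_tail Y).symm, iid_apply p k, Fin.prod_univ_succ]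
    · rfl
    · intro v hv
      rw [if_neg]
      intro h
      exact hv (congrArg Fin.tail h).symm
    · intro a ha
      rw [mul_eq_zero, PMF.map_apply]
      right
      refine ENNReal.tsum_eq_zero.2 fun v => ?_
      rw [if_neg]
      rintro rfl
      exact ha (by simp)

theorem ne_zero_of_iid_ne_zero {p : PMF B} {k : ℕ} {Y : Fin k → B} (h : iid p k Y ≠ 0) (i : Fin k) :
    p (Y i) ≠ 0 := by
  rw [iid_apply] at h
  exact Finset.prod_ne_zero_iff.1 h i (Finset.mem_univ i)

theorem tsum_iid_succ (p : PMF B) (k : ℕ) (F : (Fin (k + 1) → B) → ℝ≥0∞) :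
    ∑' Y, iid p (k + 1) Y * F Y = ∑' a, p a * ∑' Y, iid p k Y * F (Fin.cons a Y) := by
  rw [iid, tsum_bind_mul]
  simp_rw [tsum_map_mul]

theorem tsum_iid_sum (p : PMF B) (w : B → ℝ≥0∞) (k : ℕ) :
    ∑' Y, iid p k Y * ∑ j, w (Y j) = k * ∑' b, p b * w b := by
  induction k with
  | zero => simp
  | succ k ih =>
    rw [tsum_iid_succ]
    simp_rw [Fin.sum_univ_succ, Fin.cons_zero, Fin.cons_succ, mul_add, ENNReal.tsum_add, ih,
      ENNReal.tsum_mul_right, PMF.tsum_coe, one_mul, mul_add, ENNReal.tsum_add,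
      ENNReal.tsum_mul_right, PMF.tsum_coe, one_mul]
    push_cast
    ring

/-- The second moment of an i.i.d. sum; the term `k * (∑' b, p b * w b) ^ 2` stays on the left to
avoid truncated subtraction. -/
theorem tsum_iid_sum_sq (p : PMF B) (w : B → ℝ≥0∞) (k : ℕ) :
    ∑' Y, iid p k Y * (∑ j, w (Y j)) ^ 2 + k * (∑' b, p b * w b) ^ 2 =
      k * (∑' b, p b * w b ^ 2) + k ^ 2 * (∑' b, p b * w b) ^ 2 := by
  induction k with
  | zero => simp
  | succ k ih =>
    have e : ∀ a, ∑' Y, iid p k Y * (w a + ∑ j, w (Y j)) ^ 2 =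
        w a ^ 2 + 2 * (k * ∑' b, p b * w b) * w a + ∑' Y, iid p k Y * (∑ j, w (Y j)) ^ 2 := by
      intro a
      rw [← tsum_iid_sum]
      have : ∀ Y, iid p k Y * (w a + ∑ j, w (Y j)) ^ 2 = iid p k Y * w a ^ 2 +
          (2 * w a) * (iid p k Y * ∑ j, w (Y j)) + iid p k Y * (∑ j, w (Y j)) ^ 2 :=
        fun Y => by ring
      simp_rw [this, ENNReal.tsum_add, ENNReal.tsum_mul_left, ENNReal.tsum_mul_right,
        PMF.tsum_coe]
      ring
    rw [tsum_iid_succ]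
    simp_rw [Fin.sum_univ_succ, Fin.cons_zero, Fin.cons_succ, e, mul_add, ENNReal.tsum_add,
      mul_left_comm (p _) (2 * _) _, ENNReal.tsum_mul_left, ENNReal.tsum_mul_right, PMF.tsum_coe,
      one_mul]
    generalize ∑' b, p b * w b = Z at *
    generalize ∑' b, p b * w b ^ 2 = Q at *
    generalize ∑' Y, iid p k Y * (∑ j, w (Y j)) ^ 2 = E at *
    push_cast
    calc _ = Q + 2 * k * Z ^ 2 + Z ^ 2 + (E + k * Z ^ 2) := by ring
      _ = _ := by rw [ih]; ring

/-- The law of the block selected among `N` candidates drawn from `gen`, with weights `w`. -/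
noncomputable def select (gen : PMF B) (w : B → ℝ≥0∞) (N : ℕ) [NeZero N] : PMF B :=
  (iid gen N).bind fun Y => (subSample fun i => w (Y i)).map Y

theorem subSample_apply {N : ℕ} [NeZero N] {w : Fin N → ℝ≥0∞} (h0 : ∀ i, w i ≠ 0)
    (h1 : ∀ i, w i ≠ ⊤) (i : Fin N) : subSample w i = w i * (∑ j, w j)⁻¹ := by
  have h : (∑' i, w i) ≠ 0 ∧ (∑' i, w i) ≠ ⊤ := by
    rw [tsum_fintype]
    refine ⟨fun h => h0 0 (Finset.sum_eq_zero_iff.1 h 0 (Finset.mem_univ _)), ?_⟩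
    exact ENNReal.sum_ne_top.2 fun i _ => h1 i
  rw [subSample, dif_pos h, PMF.normalize_apply, tsum_fintype]

/-- By exchangeability each of the `k + 1` positions is equally likely to supply `b`; fixing that
candidate leaves `k` independent ones in the normalizer. -/
theorem select_apply {gen : PMF B} {w : B → ℝ≥0∞} (h0 : ∀ b, gen b ≠ 0 → w b ≠ 0)
    (h1 : ∀ b, gen b ≠ 0 → w b ≠ ⊤) (k : ℕ) (b : B) :
    select gen w (k + 1) b = (k + 1) * (gen b * w b *
      ∑' Y, iid gen k Y * (w b + ∑ j, w (Y j))⁻¹) := by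
  classical
  have e : ∀ Y, iid gen (k + 1) Y * ((subSample fun i => w (Y i)).map Y) b =
      ∑' i, iid gen (k + 1) Y * (if b = Y i then w (Y i) * (∑ j, w (Y j))⁻¹ else 0) := by
    intro Y
    rcases eq_or_ne (iid gen (k + 1) Y) 0 with h | h
    · simp [h]
    rw [ENNReal.tsum_mul_left, PMF.map_apply]
    congr 1
    refine tsum_congr fun i => ?_
    rw [subSample_apply (fun i => h0 _ (ne_zero_of_iid_ne_zero h i))
      (fun i => h1 _ (ne_zero_of_iid_ne_zero h i))]
  have e2 : ∀ i : Fin (k + 1), ∑' Y, iid gen (k + 1) Y *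
      (if b = Y i then w (Y i) * (∑ j, w (Y j))⁻¹ else 0) =
      gen b * w b * ∑' Y, iid gen k Y * (w b + ∑ j, w (Y j))⁻¹ := by
    intro i
    rw [← (Fin.insertNthEquiv (fun _ => B) i).tsum_eq, ENNReal.tsum_prod', tsum_eq_single b,
      ← ENNReal.tsum_mul_left]
    · refine tsum_congr fun Y => ?_
      simp only [Fin.insertNthEquiv_apply, Fin.insertNth_apply_same, if_true, iid_apply]
      rw [Fin.prod_univ_succAbove _ i, Fin.sum_univ_succAbove _ i]
      simp only [Fin.insertNth_apply_same, Fin.insertNth_apply_succAbove]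
      ring
    · intro a ha
      simp [ha.symm]
  rw [select, PMF.bind_apply]
  simp_rw [e]
  rw [ENNReal.tsum_comm]
  simp_rw [e2]
  simp

/-! ### Accuracy of self-normalized importance sampling -/

section Bounds

variable {gen : PMF B} {w : B → ℝ≥0∞} {m M : ℝ}

theorem hasSum_toReal (p : PMF α) : HasSum (fun a => (p a).toReal) 1 := by
  simpa using hasSum_toReal_mul (p := p) (F := fun _ => 1) (f := fun _ => 1) (v := 1)
    (by simp [p.tsum_coe]) (by simp) (by simp)

theorem le_tsum_weight (hw : ∀ b, gen b ≠ 0 → ENNReal.ofReal m ≤ w b) :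
    ENNReal.ofReal m ≤ ∑' b, gen b * w b := by
  calc ENNReal.ofReal m = ∑' b, gen b * ENNReal.ofReal m := by
        rw [ENNReal.tsum_mul_right, gen.tsum_coe, one_mul]
    _ ≤ _ := ENNReal.tsum_le_tsum fun b => by
        rcases eq_or_ne (gen b) 0 with h | h
        · simp [h]
        · exact mul_le_mul_right (hw b h) _

theorem tsum_weight_le (hw : ∀ b, gen b ≠ 0 → w b ≤ ENNReal.ofReal M) :
    ∑' b, gen b * w b ≤ ENNReal.ofReal M := by
  calc _ ≤ ∑' b, gen b * ENNReal.ofReal M := ENNReal.tsum_le_tsum fun b => by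
        rcases eq_or_ne (gen b) 0 with h | h
        · simp [h]
        · exact mul_le_mul_right (hw b h) _
    _ = ENNReal.ofReal M := by rw [ENNReal.tsum_mul_right, gen.tsum_coe, one_mul]

theorem tsum_weight_sq_le (hw : ∀ b, gen b ≠ 0 → w b ≤ ENNReal.ofReal M) :
    ∑' b, gen b * w b ^ 2 ≤ ENNReal.ofReal M * ∑' b, gen b * w b := by
  rw [← ENNReal.tsum_mul_left]
  refine ENNReal.tsum_le_tsum fun b => ?_
  rcases eq_or_ne (gen b) 0 with h | h
  · simp [h]
  · calc gen b * w b ^ 2 = w b * (gen b * w b) := by ring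
      _ ≤ _ := mul_le_mul_left (hw b h) _

theorem toReal_sum_weight {k : ℕ} (hw : ∀ b, gen b ≠ 0 → w b ≤ ENNReal.ofReal M) {Y : Fin k → B}
    (h : iid gen k Y ≠ 0) : (∑ j, w (Y j)) = ENNReal.ofReal (∑ j, (w (Y j)).toReal) := by
  rw [ENNReal.ofReal_sum_of_nonneg fun _ _ => ENNReal.toReal_nonneg]
  refine Finset.sum_congr rfl fun j _ => ?_
  rw [ENNReal.ofReal_toReal]
  exact ne_top_of_le_ne_top ENNReal.ofReal_ne_top (hw _ (ne_zero_of_iid_ne_zero h j))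

theorem hasSum_iid_sum (hw : ∀ b, gen b ≠ 0 → w b ≤ ENNReal.ofReal M) (k : ℕ) :
    HasSum (fun Y => (iid gen k Y).toReal * ∑ j, (w (Y j)).toReal)
      (k * (∑' b, gen b * w b).toReal) := by
  have h := hasSum_toReal_mul (f := fun Y => ∑ j, (w (Y j)).toReal) (tsum_iid_sum gen w k)
    (ENNReal.mul_ne_top (by simp) (ne_top_of_le_ne_top ENNReal.ofReal_ne_top (tsum_weight_le hw)))
    fun Y hY => by
      rw [toReal_sum_weight hw hY, ENNReal.toReal_ofReal (by positivity)]
  simpa using h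

theorem hasSum_iid_sum_sq (hw : ∀ b, gen b ≠ 0 → w b ≤ ENNReal.ofReal M) (k : ℕ) :
    HasSum (fun Y => (iid gen k Y).toReal * (∑ j, (w (Y j)).toReal) ^ 2)
      (k * (∑' b, gen b * w b ^ 2).toReal + (k ^ 2 - k) * (∑' b, gen b * w b).toReal ^ 2) := by
  have hZ := ne_top_of_le_ne_top ENNReal.ofReal_ne_top (tsum_weight_le hw)
  have hQ := ne_top_of_le_ne_top (ENNReal.mul_ne_top ENNReal.ofReal_ne_top hZ)
    (tsum_weight_sq_le hw)
  have e := tsum_iid_sum_sq gen w k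
  have hr : (k * (∑' b, gen b * w b ^ 2) + k ^ 2 * (∑' b, gen b * w b) ^ 2) ≠ ⊤ :=
    ENNReal.add_ne_top.2 ⟨ENNReal.mul_ne_top (by simp) hQ,
      ENNReal.mul_ne_top (by simp) (ENNReal.pow_ne_top hZ)⟩
  have hE : ∑' Y, iid gen k Y * (∑ j, w (Y j)) ^ 2 ≠ ⊤ := by
    rw [← e] at hr
    exact (ENNReal.add_ne_top.1 hr).1
  have h := hasSum_toReal_mul (f := fun Y => (∑ j, (w (Y j)).toReal) ^ 2) rfl hE
    fun Y hY => by
      rw [toReal_sum_weight hw hY, ENNReal.toReal_pow, ENNReal.toReal_ofReal (by positivity)]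
  convert h using 1
  have e' := congrArg ENNReal.toReal e
  rw [ENNReal.toReal_add hE (ENNReal.mul_ne_top (by simp) (ENNReal.pow_ne_top hZ)),
    ENNReal.toReal_add (ENNReal.mul_ne_top (by simp) hQ)
      (ENNReal.mul_ne_top (by simp) (ENNReal.pow_ne_top hZ))] at e'
  simp only [ENNReal.toReal_mul, ENNReal.toReal_pow, ENNReal.toReal_natCast] at e'
  linarith

/-- Exact with `T` in the last denominator; bounding only that `T` below by `c` leaves a quadratic
in `T`, whose mean needs just two moments. -/
theorem div_le_quadratic {A T c : ℝ} (hA : 0 < A) (hc : 0 < c) (hT : c ≤ T) :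
    A / T ≤ 2 - T / A + (A - T) ^ 2 / (A * c) := by
  have hT0 : 0 < T := hc.trans_le hT
  have h : A / T = 2 - T / A + (A - T) ^ 2 / (A * T) := by field_simp; ring
  rw [h]
  gcongr

theorem two_le_div_add_div {A T : ℝ} (hA : 0 < A) (hT : 0 < T) : 2 ≤ A / T + T / A := by
  rw [div_add_div _ _ hT.ne' hA.ne', le_div_iff₀ (by positivity)]
  nlinarith [sq_nonneg (A - T)]

theorem hasSum_iid_quadratic (hw : ∀ b, gen b ≠ 0 → w b ≤ ENNReal.ofReal M) (k : ℕ) (x y z t : ℝ) :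
    HasSum (fun Y => (iid gen k Y).toReal *
        (x + y * (t + ∑ j, (w (Y j)).toReal) + z * (t + ∑ j, (w (Y j)).toReal) ^ 2))
      (x + y * (t + k * (∑' b, gen b * w b).toReal) +
        z * (t ^ 2 + 2 * t * (k * (∑' b, gen b * w b).toReal) +
          (k * (∑' b, gen b * w b ^ 2).toReal +
            (k ^ 2 - k) * (∑' b, gen b * w b).toReal ^ 2))) := by
  have h0 := hasSum_toReal (iid gen k)
  have h1 := hasSum_iid_sum hw k
  have h2 := hasSum_iid_sum_sq hw k
  have h := ((h0.mul_left (x + y * t + z * t ^ 2)).add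
    (h1.mul_left (y + 2 * z * t))).add (h2.mul_left z)
  have e : (fun Y : Fin k → B => (iid gen k Y).toReal *
      (x + y * (t + ∑ j, (w (Y j)).toReal) + z * (t + ∑ j, (w (Y j)).toReal) ^ 2)) = fun Y =>
      (x + y * t + z * t ^ 2) * (iid gen k Y).toReal +
        (y + 2 * z * t) * ((iid gen k Y).toReal * ∑ j, (w (Y j)).toReal) +
        z * ((iid gen k Y).toReal * (∑ j, (w (Y j)).toReal) ^ 2) := by
    funext Y
    ring
  rw [e]
  refine Eq.mp (congrArg (fun v => HasSum _ v) ?_) h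
  ring

/-- Apply `div_le_quadratic` to `T = m + ∑ j, w (Y j)`, with `A = (k + 1) * Z`, `Z` the mean weight,
and `T ≥ (k + 1) * m`. The error is governed by the bias `Z - m` and the variance of `T`, at most `k
* M * Z`. -/
theorem tsum_iid_inv_le (hm : 0 < m)
    (hw : ∀ b, gen b ≠ 0 → ENNReal.ofReal m ≤ w b ∧ w b ≤ ENNReal.ofReal M) (k : ℕ) :
    (k + 1) * (∑' b, gen b * w b) * ∑' Y, iid gen k Y * (ENNReal.ofReal m + ∑ j, w (Y j))⁻¹ ≤
      1 + ENNReal.ofReal (3 * (M / m) / (k + 1)) := by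
  have hZe := ne_top_of_le_ne_top ENNReal.ofReal_ne_top (tsum_weight_le fun b h => (hw b h).2)
  have hQe := ne_top_of_le_ne_top (ENNReal.mul_ne_top ENNReal.ofReal_ne_top hZe)
    (tsum_weight_sq_le fun b h => (hw b h).2)
  have hmM : m ≤ M := by
    obtain ⟨b, hb⟩ := gen.support_nonempty
    have h := (hw b hb).1.trans (hw b hb).2
    by_contra! hlt
    exact absurd h (not_le.2 ((ENNReal.ofReal_lt_ofReal_iff hm).2 hlt))
  have hM : 0 < M := hm.trans_le hmM
  have hquad := fun x y z => hasSum_iid_quadratic (fun b h => (hw b h).2) k x y z m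
  have hmZ := le_tsum_weight fun b h => (hw b h).1
  have hZM := tsum_weight_le fun b h => (hw b h).2
  have hQM := tsum_weight_sq_le fun b h => (hw b h).2
  generalize hZdef : ∑' b, gen b * w b = Ze at *
  generalize ∑' b, gen b * w b ^ 2 = Qe at *
  set Z := Ze.toReal with hZ
  set Q := Qe.toReal with hQ
  have h1 : m ≤ Z := (ENNReal.ofReal_le_iff_le_toReal hZe).1 hmZ
  have h2 : Z ≤ M := by
    have := ENNReal.toReal_mono ENNReal.ofReal_ne_top hZM
    rwa [ENNReal.toReal_ofReal hM.le] at this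
  have h3 : Q ≤ M * Z := by
    have := ENNReal.toReal_mono (ENNReal.mul_ne_top ENNReal.ofReal_ne_top hZe) hQM
    rwa [ENNReal.toReal_mul, ENNReal.toReal_ofReal hM.le] at this
  have hZ0 : 0 < Z := hm.trans_le h1
  set n : ℝ := k + 1 with hn
  have hn1 : 1 ≤ n := by simp [hn]
  have hn0 : 0 < n := by positivity
  have hA : 0 < n * Z := by positivity
  have hc : 0 < n * m := by positivity
  -- The right side of `div_le_quadratic` with `A = n * Z` and `c = n * m`, expanded in powers of
  -- `T`.
  set F : (Fin k → B) → ℝ := fun Y => (2 + n * Z / (n * m)) +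
    (-1 / (n * Z) - 2 / (n * m)) * (m + ∑ j, (w (Y j)).toReal) +
    1 / (n * Z * (n * m)) * (m + ∑ j, (w (Y j)).toReal) ^ 2 with hF
  have hterm : ∀ Y, iid gen k Y ≠ 0 → n * Z / (m + ∑ j, (w (Y j)).toReal) ≤ F Y ∧
      0 < m + ∑ j, (w (Y j)).toReal := by
    intro Y hY
    have hT : n * m ≤ m + ∑ j, (w (Y j)).toReal := by
      have : ∑ j : Fin k, m ≤ ∑ j, (w (Y j)).toReal := Finset.sum_le_sum fun j _ => by
        have h := hw _ (ne_zero_of_iid_ne_zero hY j)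
        exact (ENNReal.ofReal_le_iff_le_toReal
          (ne_top_of_le_ne_top ENNReal.ofReal_ne_top h.2)).1 h.1
      rw [Finset.sum_const, Finset.card_univ, Fintype.card_fin, nsmul_eq_mul] at this
      rw [hn]
      linarith
    refine ⟨(div_le_quadratic hA hc hT).trans (le_of_eq ?_), hc.trans_le hT⟩
    rw [hF]
    field_simp
    ring
  calc _ = ∑' Y, iid gen k Y * ENNReal.ofReal (n * Z / (m + ∑ j, (w (Y j)).toReal)) := by
        rw [← ENNReal.tsum_mul_left]
        refine tsum_congr fun Y => ?_
        rcases eq_or_ne (iid gen k Y) 0 with h | h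
        · simp [h]
        rw [ENNReal.ofReal_div_of_pos (hterm Y h).2, ENNReal.ofReal_mul hn0.le,
          ENNReal.ofReal_toReal hZe, ENNReal.ofReal_add hm.le (by positivity),
          ← toReal_sum_weight (fun b h => (hw b h).2) h, hn,
          ENNReal.ofReal_add (by positivity) zero_le_one, ENNReal.ofReal_one,
          ENNReal.ofReal_natCast, div_eq_mul_inv]
        ring
    _ ≤ ∑' Y, iid gen k Y * ENNReal.ofReal (F Y) := ENNReal.tsum_le_tsum fun Y => by
        rcases eq_or_ne (iid gen k Y) 0 with h | h
        · simp [h]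
        exact mul_le_mul_right (ENNReal.ofReal_le_ofReal (hterm Y h).1) _
    _ = _ := tsum_mul_ofReal (hquad _ _ _) fun Y hY =>
        le_trans (div_nonneg hA.le (hterm Y hY).2.le) (hterm Y hY).1
    _ ≤ ENNReal.ofReal (1 + 3 * (M / m) / n) := ENNReal.ofReal_le_ofReal ?_
    _ = _ := by rw [ENNReal.ofReal_add zero_le_one (by positivity), ENNReal.ofReal_one]
  have hk : (k : ℝ) = n - 1 := by rw [hn]; ring
  have hk0 : 0 ≤ n - 1 := by linarith
  rw [hk]
  -- The middle term is the relative bias `E[A - T] / A`; the numerator of the last is `E[(A - T) ^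
  -- 2]`, squared bias plus variance.
  have e : (2 + n * Z / (n * m) + (-1 / (n * Z) - 2 / (n * m)) * (m + (n - 1) * Z) +
      1 / (n * Z * (n * m)) * (m ^ 2 + 2 * m * ((n - 1) * Z) +
        ((n - 1) * Q + ((n - 1) ^ 2 - (n - 1)) * Z ^ 2))) =
      1 + (Z - m) / (n * Z) + ((Z - m) ^ 2 + (n - 1) * (Q - Z ^ 2)) / (n ^ 2 * Z * m) := by
    field_simp
    ring
  rw [e]
  have e1 : (Z - m) / (n * Z) ≤ (M / m) / n := by
    rw [div_div, div_le_div_iff₀ hA (by positivity)]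
    have : (Z - m) * m ≤ M * Z := mul_le_mul (by linarith) h1 hm.le hM.le
    nlinarith
  have e2 : ((Z - m) ^ 2 + (n - 1) * (Q - Z ^ 2)) / (n ^ 2 * Z * m) ≤ 2 * (M / m) / n := by
    have a1 : (Z - m) ^ 2 ≤ M * Z := by nlinarith
    have a2 : (n - 1) * (Q - Z ^ 2) ≤ (n - 1) * (M * Z) :=
      mul_le_mul_of_nonneg_left (by nlinarith) hk0
    calc _ ≤ (n * (M * Z)) / (n ^ 2 * Z * m) := by
          gcongr
          linarith
      _ = (M / m) / n := by field_simp
      _ ≤ _ := by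
          gcongr
          have : 0 ≤ M / m := by positivity
          linarith
  calc _ ≤ 1 + (M / m) / n + 2 * (M / m) / n := by linarith
    _ = _ := by ring

/-- By convexity `A / T ≥ 2 - T / A`, so the mean of `T` suffices. It exceeds `A = (k + 1) * Z` by
at most `w b - Z`, a relative excess of at most `(M / m) / (k + 1)`; the factor 3 matches the upper
bound. -/
theorem le_tsum_iid_inv (hm : 0 < m)
    (hw : ∀ b, gen b ≠ 0 → ENNReal.ofReal m ≤ w b ∧ w b ≤ ENNReal.ofReal M) (k : ℕ) {b : B}
    (hb : gen b ≠ 0) :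
    1 ≤ (k + 1) * (∑' b, gen b * w b) * (∑' Y, iid gen k Y * (w b + ∑ j, w (Y j))⁻¹) +
      ENNReal.ofReal (3 * (M / m) / (k + 1)) := by
  have hZe := ne_top_of_le_ne_top ENNReal.ofReal_ne_top (tsum_weight_le fun b h => (hw b h).2)
  have hquad := fun x y => hasSum_iid_quadratic (fun b h => (hw b h).2) k x y 0 (w b).toReal
  have hmZ := le_tsum_weight fun b h => (hw b h).1
  have hwb : w b ≠ ⊤ := ne_top_of_le_ne_top ENNReal.ofReal_ne_top (hw b hb).2
  generalize hZdef : ∑' b, gen b * w b = Ze at *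
  set Z := Ze.toReal with hZ
  set t := (w b).toReal with ht
  have h1 : m ≤ Z := (ENNReal.ofReal_le_iff_le_toReal hZe).1 hmZ
  have hmt : m ≤ t := (ENNReal.ofReal_le_iff_le_toReal hwb).1 (hw b hb).1
  have hM : 0 < M := by
    by_contra! h
    have := (hw b hb).1.trans (hw b hb).2
    rw [ENNReal.ofReal_of_nonpos h, nonpos_iff_eq_zero, ENNReal.ofReal_eq_zero] at this
    linarith
  have htM : t ≤ M := by
    have := ENNReal.toReal_mono ENNReal.ofReal_ne_top (hw b hb).2
    rwa [ENNReal.toReal_ofReal hM.le] at this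
  have hZ0 : 0 < Z := hm.trans_le h1
  have ht0 : 0 < t := hm.trans_le hmt
  set n : ℝ := k + 1 with hn
  have hn0 : 0 < n := by positivity
  have hA : 0 < n * Z := by positivity
  have hT : ∀ Y : Fin k → B, 0 < t + ∑ j, (w (Y j)).toReal := fun Y => by positivity
  have hsum : ∑' Y, iid gen k Y * ENNReal.ofReal ((t + ∑ j, (w (Y j)).toReal) / (n * Z)) =
      ENNReal.ofReal ((t + k * Z) / (n * Z)) := by
    refine tsum_mul_ofReal ?_ fun Y _ => div_nonneg (hT Y).le hA.le
    convert hquad 0 (n * Z)⁻¹ using 1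
    · ext Y
      ring
    · ring
  have h2 : (2 : ℝ≥0∞) ≤
      n.toNNReal * Ze * (∑' Y, iid gen k Y * (w b + ∑ j, w (Y j))⁻¹) +
        ENNReal.ofReal ((t + k * Z) / (n * Z)) := by
    rw [← hsum, ← ENNReal.tsum_mul_left, ← ENNReal.tsum_add]
    calc (2 : ℝ≥0∞) = ∑' Y, iid gen k Y * 2 := by rw [ENNReal.tsum_mul_right, PMF.tsum_coe, one_mul]
      _ ≤ _ := ENNReal.tsum_le_tsum fun Y => ?_
    rcases eq_or_ne (iid gen k Y) 0 with h | h
    · simp [h]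
    have e := ENNReal.ofReal_le_ofReal (two_le_div_add_div hA (hT Y))
    rw [ENNReal.ofReal_add (div_nonneg hA.le (hT Y).le) (div_nonneg (hT Y).le hA.le),
      ENNReal.ofReal_div_of_pos (hT Y), ENNReal.ofReal_mul hn0.le, ENNReal.ofReal_toReal hZe,
      ENNReal.ofReal_add ht0.le (by positivity), ENNReal.ofReal_toReal hwb,
      ← toReal_sum_weight (fun b h => (hw b h).2) h, ENNReal.ofReal_ofNat] at e
    calc iid gen k Y * 2 ≤ _ := mul_le_mul_right e _
      _ = _ := by rw [div_eq_mul_inv, ENNReal.ofReal]; ring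
  have h3 : (t + k * Z) / (n * Z) ≤ 1 + 3 * (M / m) / n := by
    have hk : (k : ℝ) = n - 1 := by rw [hn]; ring
    have e : t / (n * Z) ≤ (M / m) / n := by
      rw [mul_comm n Z, ← div_div]
      gcongr
    have e0 : 0 ≤ (M / m) / n := by positivity
    calc (t + k * Z) / (n * Z) = t / (n * Z) + (1 - 1 / n) := by rw [hk]; field_simp
      _ ≤ (M / m) / n + 1 := by
          have : 0 ≤ 1 / n := by positivity
          linarith
      _ ≤ 1 + 3 * ((M / m) / n) := by linarith
      _ = _ := by ring
  have h4 := h2.trans (add_le_add_right (ENNReal.ofReal_le_ofReal h3) _)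
  rw [ENNReal.ofReal_add zero_le_one (by positivity), ENNReal.ofReal_one,
    add_left_comm, ← one_add_one_eq_two] at h4
  have h5 := (ENNReal.add_le_add_iff_left ENNReal.one_ne_top).1 h4
  have hnn : (n.toNNReal : ℝ≥0∞) = k + 1 := by
    change ENNReal.ofReal n = _
    rw [hn, ENNReal.ofReal_add (by positivity) zero_le_one, ENNReal.ofReal_one,
      ENNReal.ofReal_natCast]
  rwa [hnn] at h5

/-- Self-normalized importance sampling with `N` candidates is accurate up to a factor
`1 ± 3 κ / N`, where `κ` is the ratio of the largest to the smallest weight. -/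
theorem near_select (hm : 0 < m)
    (hw : ∀ b, gen b ≠ 0 → ENNReal.ofReal m ≤ w b ∧ w b ≤ ENNReal.ofReal M) {Q : PMF B}
    (hQ : ∀ b, Q b * ∑' b, gen b * w b = gen b * w b) (N : ℕ) [NeZero N] :
    Near (ENNReal.ofReal (3 * (M / m) / N)) (select gen w N) Q := by
  obtain _ | k := N
  · exact absurd rfl (NeZero.ne 0)
  have hm' : ENNReal.ofReal m ≠ 0 := (ENNReal.ofReal_pos.2 hm).ne'
  have hZ0 : ∑' b, gen b * w b ≠ 0 := fun h => hm'
    (nonpos_iff_eq_zero.1 (h ▸ le_tsum_weight fun b h => (hw b h).1))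
  have h0 : ∀ b, gen b ≠ 0 → w b ≠ 0 := fun b hb h => hm' (nonpos_iff_eq_zero.1 (h ▸ (hw b hb).1))
  have h1 : ∀ b, gen b ≠ 0 → w b ≠ ⊤ := fun b hb =>
    ne_top_of_le_ne_top ENNReal.ofReal_ne_top (hw b hb).2
  intro b
  -- Both bounds reduce to the mean of `A / T`, the density of the selected block relative to `Q`.
  have e : select gen w (k + 1) b = Q b * ((k + 1) * (∑' b, gen b * w b) *
      ∑' Y, iid gen k Y * (w b + ∑ j, w (Y j))⁻¹) := by
    rw [select_apply h0 h1, ← hQ]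
    ring
  have hc : ((k + 1 : ℕ) : ℝ) = k + 1 := Nat.cast_succ k
  rw [hc, e]
  rcases eq_or_ne (gen b) 0 with hb | hb
  · have : Q b = 0 := by
      have := hQ b
      rw [hb, zero_mul] at this
      exact (mul_eq_zero.1 this).resolve_right hZ0
    simp [this]
  constructor
  -- Lowering `w b` to `m` in the normalizer makes the upper bound independent of `b`.
  · calc _ ≤ Q b * (1 + ENNReal.ofReal (3 * (M / m) / (k + 1))) := by
          refine mul_le_mul_right (le_trans (mul_le_mul_right ?_ _) (tsum_iid_inv_le hm hw k)) _
          refine ENNReal.tsum_le_tsum fun Y => mul_le_mul_right (ENNReal.inv_le_inv.2 ?_) _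
          gcongr
          exact (hw b hb).1
      _ = _ := by ring
  · calc Q b = Q b * 1 := (mul_one _).symm
      _ ≤ _ := mul_le_mul_right (le_tsum_iid_inv hm hw k hb) _
      _ = _ := by ring

end Bounds

end SPECS
-- The random beam-width
namespace SPECS

variable {X B : Type*}

/-- For the Poisson weights, `P k / (k + 1) = P (k + 1) / n` and `1 / k ≤ 2 / (k + 1)`. The shift
only loses mass, and the conditioning constant cancels. -/
theorem tsum_inv_beamWidth_le {n : ℕ+} {ν : PMF ℕ+} (hν : ν = PMF.pure n ∨ ν = positivePoisson n)
    {a : ℝ} (ha : 0 ≤ a) :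
    ∑' N : ℕ+, ν N * ENNReal.ofReal (a / ((N : ℕ) : ℝ)) ≤
      ENNReal.ofReal (2 * a / ((n : ℕ) : ℝ)) := by
  have hn : (0 : ℝ) < ((n : ℕ) : ℝ) := by exact_mod_cast n.pos
  rcases hν with rfl | rfl
  · rw [tsum_pure_mul]
    refine ENNReal.ofReal_le_ofReal ?_
    gcongr
    linarith
  set P : ℕ+ → ℝ≥0∞ := fun k => poissonMeasure ((n : ℕ) : ℝ≥0) {(k : ℕ)} with hP
  have hterm : ∀ k : ℕ+, P k * ENNReal.ofReal (a / ((k : ℕ) : ℝ)) ≤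
      ENNReal.ofReal (2 * a / ((n : ℕ) : ℝ)) * P (k + 1) := by
    intro k
    have hk : (1 : ℝ) ≤ ((k : ℕ) : ℝ) := by exact_mod_cast k.pos
    simp only [hP, poissonMeasure_singleton]
    rw [← ENNReal.ofReal_mul (by positivity), ← ENNReal.ofReal_mul (by positivity)]
    refine ENNReal.ofReal_le_ofReal ?_
    rw [PNat.add_coe, PNat.one_coe, Nat.factorial_succ, pow_succ]
    push_cast
    generalize hE : Real.exp (-((n : ℕ) : ℝ)) * ((n : ℕ) : ℝ) ^ (k : ℕ) = E
    have hE0 : 0 ≤ E := by rw [← hE]; positivity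
    generalize hF : (((k : ℕ).factorial : ℕ) : ℝ) = F
    have hF0 : 0 < F := by rw [← hF]; exact_mod_cast Nat.factorial_pos _
    calc E / F * (a / ((k : ℕ) : ℝ)) ≤ E / F * (2 * a / (((k : ℕ) : ℝ) + 1)) := by
          refine mul_le_mul_of_nonneg_left ?_ (by positivity)
          rw [div_le_div_iff₀ (by positivity) (by positivity)]
          nlinarith
      _ = _ := by
          rw [← mul_assoc, hE]
          field_simp
  have hsum : ∑' k, P (k + 1) ≤ ∑' k, P k :=
    ENNReal.tsum_comp_le_tsum_of_injective (add_left_injective 1) P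
  have h0 := poisson_tsum_ne_zero n
  have h1 := poisson_tsum_ne_top n
  calc _ = ∑' N : ℕ+, P N * ENNReal.ofReal (a / ((N : ℕ) : ℝ)) * (∑' k, P k)⁻¹ := by
        refine tsum_congr fun N => ?_
        rw [positivePoisson, PMF.normalize_apply]
        ring
    _ ≤ ∑' N : ℕ+, ENNReal.ofReal (2 * a / ((n : ℕ) : ℝ)) * P (N + 1) * (∑' k, P k)⁻¹ :=
        ENNReal.tsum_le_tsum fun N => mul_le_mul_left (hterm N) _
    _ = ENNReal.ofReal (2 * a / ((n : ℕ) : ℝ)) * (∑' k, P (k + 1)) * (∑' k, P k)⁻¹ := by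
        rw [ENNReal.tsum_mul_right, ENNReal.tsum_mul_left]
    _ ≤ ENNReal.ofReal (2 * a / ((n : ℕ) : ℝ)) * (∑' k, P k) * (∑' k, P k)⁻¹ := by gcongr
    _ = _ := by rw [mul_assoc, ENNReal.mul_inv_cancel h0 h1, mul_one]

/-! ### The optimal policy as a blockwise policy -/

theorem complete_succ_eq_snoc (π : Policy X B) (x : X) (k : ℕ) (s : List B) :
    complete π x (k + 1) s = snoc (complete π x k s) (π x) := by
  induction k generalizing s with
  | zero =>
    simp only [complete, snoc, PMF.pure_bind]
    rfl
  | succ k ih =>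
    calc complete π x (k + 1 + 1) s = (π x s).bind fun b => snoc (complete π x k (s ++ [b])) (π x) :=
          congrArg (π x s).bind (funext fun b => ih (s ++ [b]))
      _ = _ := by simp only [snoc, complete, PMF.bind_bind]

theorem length_of_complete_ne_zero {π : Policy X B} {x : X} {k : ℕ} {s y : List B}
    (h : complete π x k s y ≠ 0) : y.length = s.length + k := by
  induction k generalizing y with
  | zero =>
    rw [complete, PMF.pure_apply] at h
    by_cases hy : y = s
    · simp [hy]
    · simp [hy] at h
  | succ k ih =>
    rw [complete_succ_eq_snoc] at h
    rcases List.eq_nil_or_concat y with rfl | ⟨t, b, rfl⟩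
    · exact absurd (snoc_nil _ _) h
    · rw [List.concat_eq_append, snoc_append] at h
      simp [ih (left_ne_zero_of_mul h)]
      ring

/-- `𝔼[exp(β r(x, Y))]`, `Y` a completion by `π` of the partial trace `s`. -/
noncomputable def moment (π : Policy X B) (r : X → List B → ℝ) (β : ℝ) (H : ℕ) (x : X)
    (s : List B) : ℝ≥0∞ :=
  ∑' y, complete π x (H - s.length) s y * ENNReal.ofReal (Real.exp (β * r x y))

section Optimal

variable {π : Policy X B} {r : X → List B → ℝ} {β : ℝ} {H : ℕ} {x : X}

theorem moment_ne_zero (s : List B) : moment π r β H x s ≠ 0 := by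
  obtain ⟨y, hy⟩ := (complete π x (H - s.length) s).support_nonempty
  intro h
  have := ENNReal.tsum_eq_zero.1 h y
  rw [mul_eq_zero, ENNReal.ofReal_eq_zero] at this
  exact this.elim hy fun h => absurd h (not_le.2 (Real.exp_pos _))

theorem moment_of_length_eq {y : List B} (h : y.length = H) :
    moment π r β H x y = ENNReal.ofReal (Real.exp (β * r x y)) := by
  rw [moment, h, Nat.sub_self, complete, tsum_pure_mul]

theorem moment_eq_tsum {s : List B} (h : s.length < H) :
    moment π r β H x s = ∑' b, π x s b * moment π r β H x (s ++ [b]) := by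
  have e : H - s.length = (H - (s.length + 1)) + 1 := by omega
  simp only [moment, List.length_append, List.length_singleton]
  rw [e, complete, tsum_bind_mul]

theorem ofReal_integral_eq_moment {s : List B}
    (hint : Integrable (fun y => Real.exp (β * r x y)) (law (complete π x (H - s.length) s))) :
    ENNReal.ofReal (∫ y, Real.exp (β * r x y) ∂(law (complete π x (H - s.length) s))) =
      moment π r β H x s := by
  rw [ofReal_integral_eq_lintegral_ofReal hint (Filter.Eventually.of_forall fun y =>
    (Real.exp_pos _).le), lintegral_law, moment]

theorem moment_ne_top {s : List B}
    (hint : Integrable (fun y => Real.exp (β * r x y)) (law (complete π x (H - s.length) s))) :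
    moment π r β H x s ≠ ⊤ := by
  rw [← ofReal_integral_eq_moment hint]
  exact ENNReal.ofReal_ne_top

theorem integral_eq_moment {s : List B}
    (hint : Integrable (fun y => Real.exp (β * r x y)) (law (complete π x (H - s.length) s))) :
    ∫ y, Real.exp (β * r x y) ∂(law (complete π x (H - s.length) s)) =
      (moment π r β H x s).toReal := by
  rw [← ofReal_integral_eq_moment hint, ENNReal.toReal_ofReal]
  exact integral_nonneg fun y => (Real.exp_pos _).le

theorem ofReal_exp_value (hβ : β ≠ 0) {s : List B}
    (hint : Integrable (fun y => Real.exp (β * r x y)) (law (complete π x (H - s.length) s))) :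
    ENNReal.ofReal (Real.exp (β * value π r β H x s)) = moment π r β H x s := by
  rw [value, integral_eq_moment hint, ← mul_assoc, mul_one_div_cancel hβ, one_mul, Real.exp_log
    (ENNReal.toReal_pos (moment_ne_zero s) (moment_ne_top hint)),
    ENNReal.ofReal_toReal (moment_ne_top hint)]

/-- The blockwise conditional distributions of the optimal policy. -/
theorem exists_optimal_step (hβ : β ≠ 0)
    (hint : ∀ s, s.length ≤ H → Integrable (fun y => Real.exp (β * r x y))
      (law (complete π x (H - s.length) s))) :
    ∃ S : List B → PMF B, ∀ s, s.length < H → ∀ b,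
      S s b = π x s b * ENNReal.ofReal (Real.exp (β * idealPRM π r β H x s b)) ∧
      S s b * moment π r β H x s = π x s b * moment π r β H x (s ++ [b]) := by
  have key : ∀ s, s.length < H → ∀ b,
      ENNReal.ofReal (Real.exp (β * idealPRM π r β H x s b)) * moment π r β H x s =
        moment π r β H x (s ++ [b]) := by
    intro s hs b
    rw [← ofReal_exp_value hβ (hint s hs.le),
      ← ofReal_exp_value hβ (hint (s ++ [b]) (by simpa using hs)),
      ← ENNReal.ofReal_mul (Real.exp_nonneg _), ← Real.exp_add, idealPRM]
    congr 2
    ring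
  -- The idealized PRM needs no normalizer: `moment` at `s` is the target average of `moment` at `s
  -- ++ [b]`.
  have hsum : ∀ s, s.length < H →
      ∑' b, π x s b * ENNReal.ofReal (Real.exp (β * idealPRM π r β H x s b)) = 1 := by
    intro s hs
    have h : (∑' b, π x s b * ENNReal.ofReal (Real.exp (β * idealPRM π r β H x s b))) *
        moment π r β H x s = 1 * moment π r β H x s := by
      rw [← ENNReal.tsum_mul_right, one_mul]
      simp_rw [mul_assoc, key s hs]
      exact (moment_eq_tsum hs).symm
    exact (ENNReal.mul_left_inj (moment_ne_zero s) (moment_ne_top (hint s hs.le))).1 h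
  have hS : ∀ s, ∃ p : PMF B, s.length < H →
      ∀ b, p b = π x s b * ENNReal.ofReal (Real.exp (β * idealPRM π r β H x s b)) := by
    intro s
    by_cases hs : s.length < H
    · exact ⟨⟨_, ENNReal.summable.hasSum_iff.2 (hsum s hs)⟩, fun _ b => rfl⟩
    · exact ⟨π x s, fun h => absurd h hs⟩
  choose S hS using hS
  refine ⟨S, fun s hs b => ⟨hS s hs b, ?_⟩⟩
  rw [hS s hs b, mul_assoc, key s hs]

/-- A Doob transform: the ratios of successive moments telescope along the trace. At full length the
last moment is `exp(β r)`, which yields the tilted law. -/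
theorem responseLaw_mul_moment {S : List B → PMF B}
    (hS : ∀ s, s.length < H → ∀ b,
      S s b * moment π r β H x s = π x s b * moment π r β H x (s ++ [b]))
    {k : ℕ} (hk : k ≤ H) (y : List B) :
    responseLaw (fun _ : X => S) k x y * moment π r β H x [] =
      responseLaw π k x y * moment π r β H x y := by
  induction k generalizing y with
  | zero =>
    simp only [responseLaw, complete, PMF.pure_apply]
    split_ifs with h
    · rw [h]
    · simp
  | succ k ih =>
    rw [responseLaw, complete_succ_eq_snoc, responseLaw, complete_succ_eq_snoc]
    rcases List.eq_nil_or_concat y with rfl | ⟨s, b, rfl⟩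
    · rw [snoc_nil, snoc_nil]
    rw [List.concat_eq_append, snoc_append, snoc_append]
    have e := ih (by omega) s
    rw [responseLaw, responseLaw] at e
    rcases eq_or_ne (complete π x k [] s) 0 with h0 | h0
    · rw [h0, zero_mul, mul_eq_zero] at e
      rw [h0, e.resolve_right (moment_ne_zero _)]
      simp
    · have hs : s.length = k := by simpa using length_of_complete_ne_zero h0
      calc _ = complete (fun _ : X => S) x k [] s * moment π r β H x [] * S s b := by ring
        _ = complete π x k [] s * (S s b * moment π r β H x s) := by rw [e]; ring
        _ = _ := by rw [hS s (by omega) b]; ring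

theorem optimalPolicy_eq_law {S : List B → PMF B}
    (hint : ∀ s, s.length ≤ H → Integrable (fun y => Real.exp (β * r x y))
      (law (complete π x (H - s.length) s)))
    (hS : ∀ s, s.length < H → ∀ b,
      S s b * moment π r β H x s = π x s b * moment π r β H x (s ++ [b])) :
    optimalPolicy π r β H x = law (responseLaw (fun _ : X => S) H x) := by
  have h0 := moment_ne_zero (π := π) (r := r) (β := β) (H := H) (x := x) []
  have h1 := moment_ne_top (hint [] (by simp))
  have hI := integral_eq_moment (hint [] (by simp))
  rw [optimalPolicy, Measure.tilted]
  refine (law_eq_withDensity fun y => ?_).symm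
  have hI' : ∫ y, Real.exp (β * r x y) ∂(law (responseLaw π H x)) = (moment π r β H x []).toReal :=
    hI
  rw [hI', ENNReal.ofReal_div_of_pos (ENNReal.toReal_pos h0 h1), ENNReal.ofReal_toReal h1,
    ← mul_div_assoc]
  refine (ENNReal.eq_div_iff h0 h1).2 ?_
  rw [mul_comm, responseLaw_mul_moment hS le_rfl]
  rcases eq_or_ne (responseLaw π H x y) 0 with hy | hy
  · simp [hy]
  · rw [moment_of_length_eq (by simpa using length_of_complete_ne_zero hy)]

end Optimal

end SPECS
-- The trace process of SPECS
namespace SPECS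

variable {X B : Type*}

theorem exists_disintegration {α β : Type*} (R : PMF (α × β)) :
    ∃ κ : α → PMF β, R = (R.map Prod.fst).bind fun a => (κ a).map (Prod.mk a) := by
  classical
  have hfst : ∀ a, (R.map Prod.fst) a = ∑' b, R (a, b) := by
    intro a
    rw [PMF.map_apply, ENNReal.tsum_prod', tsum_eq_single a]
    · simp
    · intro a' ha'
      simp [ha'.symm]
  have hκ : ∀ a, ∃ p : PMF β, ∀ b, (R.map Prod.fst) a * p b = R (a, b) := by
    intro a
    rcases eq_or_ne (∑' b, R (a, b)) 0 with h | h
    -- On a null fibre any conditional law serves.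
    · refine ⟨R.map Prod.snd, fun b => ?_⟩
      rw [hfst, h, zero_mul, ENNReal.tsum_eq_zero.1 h b]
    · have ht : ∑' b, R (a, b) ≠ ⊤ := by
        rw [← hfst]
        exact PMF.apply_ne_top _ _
      refine ⟨PMF.normalize _ h ht, fun b => ?_⟩
      rw [hfst, PMF.normalize_apply, mul_left_comm, ENNReal.mul_inv_cancel h ht, mul_one]
  choose κ hκ using hκ
  refine ⟨κ, PMF.ext ?_⟩
  rintro ⟨a, b⟩
  rw [← hκ, PMF.bind_apply, tsum_eq_single a, PMF.map_apply (Prod.mk a), tsum_eq_single b]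
  · simp
  · intro b' hb'
    simp [hb'.symm]
  · intro a' ha'
    rw [mul_eq_zero, PMF.map_apply]
    right
    simp [ha'.symm]

/-- The law of the block that one iteration of SPECS appends to the trace. -/
noncomputable def blockLaw (target draft : Policy X B) (rPRM : X → List B → B → ℝ) (β : ℝ)
    (ν : PMF ℕ+) (x : X) (st : List B × Bool) : PMF B :=
  let gen : PMF B := if st.2 = true then draft x st.1 else target x st.1
  ν.bind fun N => select gen (expScore (target x st.1) gen β (rPRM x st.1)) N

section Run

variable {target draft : Policy X B} {rPRM : X → List B → B → ℝ} {β τ : ℝ} {ν : PMF ℕ+} {x : X}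

theorem map_fst_step (st : List B × Bool) :
    (step target draft rPRM β τ ν x st).map Prod.fst =
      (blockLaw target draft rPRM β ν x st).map fun b => st.1 ++ [b] := by
  simp only [step, blockLaw, select, PMF.map_bind, PMF.map_comp]
  rfl

/-- The flag carries history, so the trace alone need not be Markov. Conditioning the flag on the
trace makes the next-block law a mixture of the two block laws, and the chain rule applies. -/
theorem exists_run_eq_snoc (k : ℕ) :
    ∃ κ : List B → PMF Bool, (run target draft rPRM β τ ν x (k + 1)).map Prod.fst =
      snoc ((run target draft rPRM β τ ν x k).map Prod.fst)
        fun s => (κ s).bind fun f => blockLaw target draft rPRM β ν x (s, f) := by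
  obtain ⟨κ, hκ⟩ := exists_disintegration (run target draft rPRM β τ ν x k)
  refine ⟨κ, ?_⟩
  rw [run, PMF.map_bind]
  simp_rw [map_fst_step]
  conv_lhs => rw [hκ]
  simp only [snoc, PMF.bind_bind, PMF.bind_map, PMF.map_bind, Function.comp_def]

/-- One `Q` serves both values of the flag, so the mixture over the flag stays near `Q` whatever its
conditional law. -/
theorem klDiv_run_le {S : List B → PMF B} {H : ℕ} {η γ : ℝ} (hη : 0 ≤ η) (hγ : 0 ≤ γ)
    (hS : ∀ s, s.length < H → ∃ Q : PMF B,
      (∀ f, Near (ENNReal.ofReal η) (blockLaw target draft rPRM β ν x (s, f)) Q) ∧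
      ∀ b, Q b ≤ ENNReal.ofReal (Real.exp γ) * S s b) :
    klDiv (law (specsPolicy target draft rPRM β τ ν H x))
      (law (responseLaw (fun _ : X => S) H x)) ≤ H * ENNReal.ofReal (η ^ 2 + γ) := by
  -- Absolute continuity is carried along: the chain rule requires it, and it forces traces in the
  -- support to have length `k`.
  have key : ∀ k ≤ H,
      (∀ y, responseLaw (fun _ : X => S) k x y = 0 →
        (run target draft rPRM β τ ν x k).map Prod.fst y = 0) ∧
      pmfKL ((run target draft rPRM β τ ν x k).map Prod.fst) (responseLaw (fun _ : X => S) k x) ≤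
        k * ENNReal.ofReal (η ^ 2 + γ) := by
    intro k hk
    induction k with
    | zero =>
      have e : (run target draft rPRM β τ ν x 0).map Prod.fst =
          responseLaw (fun _ : X => S) 0 x := by
        rw [run, PMF.pure_map]
        rfl
      rw [e]
      refine ⟨fun y hy => hy, ?_⟩
      rw [← klDiv_law fun y hy => hy, klDiv_self]
      simp
    | succ k ih =>
      obtain ⟨hac, hle⟩ := ih (by omega)
      obtain ⟨κ, hκ⟩ := exists_run_eq_snoc (target := target) (draft := draft) (rPRM := rPRM)
        (β := β) (τ := τ) (ν := ν) (x := x) k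
      have hresp : responseLaw (fun _ : X => S) (k + 1) x =
          snoc (responseLaw (fun _ : X => S) k x) S := complete_succ_eq_snoc _ _ _ _
      rw [hκ, hresp]
      generalize (run target draft rPRM β τ ν x k).map Prod.fst = p at hac hle
      have hnear : ∀ s, p s ≠ 0 → ∃ Q : PMF B, Near (ENNReal.ofReal η)
          ((κ s).bind fun f => blockLaw target draft rPRM β ν x (s, f)) Q ∧
          ∀ b, Q b ≤ ENNReal.ofReal (Real.exp γ) * S s b := by
        intro s hs
        have hlen : s.length = k := by
          simpa using length_of_complete_ne_zero fun h => hs (hac s h)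
        obtain ⟨Q, hQ, hQS⟩ := hS s (by omega)
        refine ⟨Q, (Near.bind (κ s) hQ).mono ?_, hQS⟩
        rw [ENNReal.tsum_mul_right, PMF.tsum_coe, one_mul]
      have hacK : ∀ s, p s ≠ 0 → ∀ b, S s b = 0 →
          ((κ s).bind fun f => blockLaw target draft rPRM β ν x (s, f)) b = 0 := by
        intro s hs b hb
        obtain ⟨Q, hQ, hQS⟩ := hnear s hs
        exact hQ.apply_eq_zero (by simpa [hb] using hQS b)
      constructor
      · intro y hy
        rcases List.eq_nil_or_concat y with rfl | ⟨s, b, rfl⟩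
        · exact snoc_nil _ _
        rw [List.concat_eq_append, snoc_append, mul_eq_zero] at hy ⊢
        by_cases hs : p s = 0
        · exact Or.inl hs
        · exact Or.inr (hacK s hs b (hy.resolve_left fun h => hs (hac s h)))
      · rw [pmfKL_snoc hac hacK]
        calc _ ≤ k * ENNReal.ofReal (η ^ 2 + γ) + ∑' s, p s * ENNReal.ofReal (η ^ 2 + γ) := by
              refine add_le_add hle (ENNReal.tsum_le_tsum fun s => ?_)
              rcases eq_or_ne (p s) 0 with hs | hs
              · simp [hs]
              obtain ⟨Q, hQ, hQS⟩ := hnear s hs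
              exact mul_le_mul_right (pmfKL_le_of_near hη hγ hQ hQS) _
          _ = _ := by
              rw [ENNReal.tsum_mul_right, p.tsum_coe]
              push_cast
              ring
  rw [specsPolicy, klDiv_law (key H le_rfl).1]
  exact (key H le_rfl).2

end Run

/-! ### One block: coverage, weights and the misspecified tilt -/

theorem le_ratioSup_mul {p q : PMF B} (h : ratioSup p q ≠ ⊤) (b : B) : p b ≤ ratioSup p q * q b :=
  (ENNReal.div_le_iff_le_mul (Or.inr h) (Or.inl (q.apply_ne_top b))).1
    (le_iSup (fun b => p b / q b) b)

theorem one_le_ratioSup (p q : PMF B) : 1 ≤ ratioSup p q := by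
  by_cases h : ratioSup p q = ⊤
  · simp [h]
  calc (1 : ℝ≥0∞) = ∑' b, p b := p.tsum_coe.symm
    _ ≤ ∑' b, ratioSup p q * q b := ENNReal.tsum_le_tsum fun b => le_ratioSup_mul h b
    _ = _ := by rw [ENNReal.tsum_mul_left, q.tsum_coe, mul_one]

theorem ratioSup_self_le (p : PMF B) : ratioSup p p ≤ 1 :=
  iSup_le fun _ => ENNReal.div_self_le_one

section Block

variable {T G Q : PMF B} {β R a c : ℝ} {r : B → ℝ}

/-- The importance weight cancels the generator; finiteness of the ratio makes `T` vanish where `G`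
does. -/
theorem mul_expScore (h : ratioSup T G ≠ ⊤) (b : B) :
    G b * expScore T G β r b = T b * ENNReal.ofReal (Real.exp (β * r b)) := by
  rw [expScore, ← mul_assoc, ENNReal.mul_div_cancel' _ fun ht => absurd ht (G.apply_ne_top b)]
  intro h0
  simpa [h0] using le_ratioSup_mul h b

/-- The density ratio `T / G` varies by a factor at most `c` and the tilt by at most `exp(βR)`. The
6 is 3 from `near_select` times 2 from the mean of `1 / N`. -/
theorem near_bind_select (hβ : 0 ≤ β) (hr : ∀ b, r b ∈ Set.Icc a (a + R)) (hc : 0 ≤ c)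
    (hTG : ratioSup T G * ratioSup G T ≤ ENNReal.ofReal c)
    (hQ : ∀ b, Q b * ∑' b, T b * ENNReal.ofReal (Real.exp (β * r b)) =
      T b * ENNReal.ofReal (Real.exp (β * r b)))
    {n : ℕ+} {ν : PMF ℕ+} (hν : ν = PMF.pure n ∨ ν = positivePoisson n) :
    Near (ENNReal.ofReal (6 * (c * Real.exp (β * R)) / ((n : ℕ) : ℝ)))
      (ν.bind fun N => select G (expScore T G β r) N) Q := by
  have h1 := one_le_ratioSup T G
  have h2 := one_le_ratioSup G T
  have hne : ratioSup T G * ratioSup G T ≠ ⊤ := ne_top_of_le_ne_top ENNReal.ofReal_ne_top hTG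
  have hE1 : ratioSup T G ≠ ⊤ := fun h => hne (by
    rw [h, ENNReal.top_mul (zero_lt_one.trans_le h2).ne'])
  have hE2 : ratioSup G T ≠ ⊤ := fun h => hne (by
    rw [h, ENNReal.mul_top (zero_lt_one.trans_le h1).ne'])
  have hl : ∀ b, T b / G b ≤ ratioSup T G := le_iSup fun b => T b / G b
  have hu : ∀ b, G b / T b ≤ ratioSup G T := le_iSup fun b => G b / T b
  have hsc := mul_expScore (T := T) (G := G) (β := β) (r := r) hE1
  set E1 := ratioSup T G
  set E2 := ratioSup G T
  have hE2pos : 0 < E2.toReal := ENNReal.toReal_pos (zero_lt_one.trans_le h2).ne' hE2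
  set m : ℝ := E2.toReal⁻¹ * Real.exp (β * a) with hm
  set M : ℝ := E1.toReal * Real.exp (β * (a + R)) with hM
  have hm0 : 0 < m := by positivity
  have hw : ∀ b, G b ≠ 0 → ENNReal.ofReal m ≤ expScore T G β r b ∧
      expScore T G β r b ≤ ENNReal.ofReal M := by
    intro b hb
    constructor
    · rw [hm, ENNReal.ofReal_mul (by positivity), ENNReal.ofReal_inv_of_pos hE2pos,
        ENNReal.ofReal_toReal hE2, expScore]
      refine mul_le_mul' ?_ (ENNReal.ofReal_le_ofReal (Real.exp_le_exp.2
        (mul_le_mul_of_nonneg_left (hr b).1 hβ)))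
      rw [← ENNReal.inv_div (Or.inl (T.apply_ne_top b)) (Or.inr hb)]
      exact ENNReal.inv_le_inv.2 (hu b)
    · rw [hM, ENNReal.ofReal_mul (by positivity), ENNReal.ofReal_toReal hE1, expScore]
      exact mul_le_mul' (hl b) (ENNReal.ofReal_le_ofReal (Real.exp_le_exp.2
        (mul_le_mul_of_nonneg_left (hr b).2 hβ)))
  have hQ' : ∀ b, Q b * ∑' b, G b * expScore T G β r b = G b * expScore T G β r b := by
    simpa only [hsc] using hQ
  have hMm : M / m ≤ c * Real.exp (β * R) := by
    have e : M / m = (E1 * E2).toReal * Real.exp (β * R) := by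
      rw [hM, hm, mul_add, Real.exp_add, ENNReal.toReal_mul]
      field_simp
    rw [e]
    gcongr
    exact ENNReal.toReal_le_of_le_ofReal hc hTG
  have hMm0 : 0 ≤ M / m := by positivity
  refine (Near.bind ν fun N : ℕ+ => near_select hm0 hw hQ' (N : ℕ)).mono ?_
  refine (tsum_inv_beamWidth_le hν (by positivity)).trans (ENNReal.ofReal_le_ofReal ?_)
  have e : 2 * (3 * (M / m)) = 6 * (M / m) := by ring
  rw [e]
  gcongr

/-- One factor `exp(βε)` comes from the numerator of `Q` and one from its normalizer, since `S` has
normalizer one. -/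
theorem exists_tilt {S : PMF B} {i : B → ℝ} {ε : ℝ} (hβ : 0 ≤ β)
    (hS : ∀ b, S b = T b * ENNReal.ofReal (Real.exp (β * i b))) (hε : ∀ b, |r b - i b| ≤ ε) :
    ∃ Q : PMF B, (∀ b, Q b * ∑' b, T b * ENNReal.ofReal (Real.exp (β * r b)) =
      T b * ENNReal.ofReal (Real.exp (β * r b))) ∧
      ∀ b, Q b ≤ ENNReal.ofReal (Real.exp (2 * (β * ε))) * S b := by
  have hle : ∀ u v : B → ℝ, (∀ b, u b - v b ≤ ε) → ∀ b,
      T b * ENNReal.ofReal (Real.exp (β * u b)) ≤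
        ENNReal.ofReal (Real.exp (β * ε)) * (T b * ENNReal.ofReal (Real.exp (β * v b))) := by
    intro u v huv b
    rw [mul_left_comm, ← ENNReal.ofReal_mul (Real.exp_nonneg _), ← Real.exp_add]
    refine mul_le_mul_right (ENNReal.ofReal_le_ofReal (Real.exp_le_exp.2 ?_)) _
    nlinarith [huv b]
  have h1 := hle r i fun b => (abs_le.1 (hε b)).2
  have h2 := hle i r fun b => by linarith [(abs_le.1 (hε b)).1]
  simp_rw [← hS] at h1 h2
  set Z := ∑' b, T b * ENNReal.ofReal (Real.exp (β * r b)) with hZ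
  have hZ1 : 1 ≤ ENNReal.ofReal (Real.exp (β * ε)) * Z := by
    rw [hZ, ← ENNReal.tsum_mul_left, ← S.tsum_coe]
    exact ENNReal.tsum_le_tsum h2
  have hZ0 : Z ≠ 0 := fun h => by simp [h] at hZ1
  have hZt : Z ≠ ⊤ := by
    refine ne_top_of_le_ne_top (b := ENNReal.ofReal (Real.exp (β * ε))) ENNReal.ofReal_ne_top ?_
    calc Z ≤ ∑' b, ENNReal.ofReal (Real.exp (β * ε)) * S b := ENNReal.tsum_le_tsum h1
      _ = _ := by rw [ENNReal.tsum_mul_left, S.tsum_coe, mul_one]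
  have hQ : ∀ b, PMF.normalize _ hZ0 hZt b * Z = T b * ENNReal.ofReal (Real.exp (β * r b)) := by
    intro b
    rw [PMF.normalize_apply, mul_assoc, ENNReal.inv_mul_cancel hZ0 hZt, mul_one]
  refine ⟨PMF.normalize _ hZ0 hZt, hQ, fun b => ?_⟩
  calc PMF.normalize _ hZ0 hZt b = PMF.normalize _ hZ0 hZt b * 1 := (mul_one _).symm
    _ ≤ PMF.normalize _ hZ0 hZt b * (ENNReal.ofReal (Real.exp (β * ε)) * Z) :=
      mul_le_mul_right hZ1 _
    _ = ENNReal.ofReal (Real.exp (β * ε)) * (T b * ENNReal.ofReal (Real.exp (β * r b))) := by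
      rw [mul_left_comm, hQ]
    _ ≤ ENNReal.ofReal (Real.exp (β * ε)) * (ENNReal.ofReal (Real.exp (β * ε)) * S b) :=
      mul_le_mul_right (h1 b) _
    _ = _ := by
      rw [← mul_assoc, ← ENNReal.ofReal_mul (Real.exp_nonneg _), ← Real.exp_add, ← two_mul]

end Block

/-! ### Assembling the bound -/

theorem mul_ofReal_le_errorRate {H : ℕ} {β R ε c : ℝ} (hc : 0 ≤ c) (hβ : 0 ≤ β) (hε : 0 ≤ ε)
    (n : ℕ+) :
    H * ENNReal.ofReal ((6 * (c * Real.exp (β * R)) / ((n : ℕ) : ℝ)) ^ 2 + 2 * (β * ε)) ≤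
      ENNReal.ofReal 36 * errorRate H β R ε n (ENNReal.ofReal c) := by
  have hn : (1 : ℝ) ≤ ((n : ℕ) : ℝ) := by exact_mod_cast n.pos
  rw [errorRate, ← ENNReal.ofReal_natCast, ← ENNReal.ofReal_pow hc,
    ← ENNReal.ofReal_mul (by positivity), ← ENNReal.ofReal_mul (by positivity),
    ← ENNReal.ofReal_mul (by positivity), ← ENNReal.ofReal_add (by positivity) (by positivity),
    ← ENNReal.ofReal_mul (by positivity)]
  refine ENNReal.ofReal_le_ofReal ?_
  -- The actual rate is `n ^ (-2)`, weakened here to `n ^ (-3/2)`.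
  have h1 : (c * Real.exp (β * R) / ((n : ℕ) : ℝ)) ^ 2 ≤
      c ^ 2 * (Real.exp (2 * β * R) / ((n : ℕ) : ℝ) ^ (3 / 2 : ℝ)) := by
    rw [div_pow, mul_pow, mul_div_assoc, ← Real.exp_nat_mul]
    have e : ((2 : ℕ) : ℝ) * (β * R) = 2 * β * R := by push_cast; ring
    rw [e, ← Real.rpow_natCast ((n : ℕ) : ℝ) 2]
    gcongr
    norm_num
  have h2 : 0 ≤ β * ε := by positivity
  calc _ ≤ (H : ℝ) * (36 * (c ^ 2 * (Real.exp (2 * β * R) / ((n : ℕ) : ℝ) ^ (3 / 2 : ℝ))) +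
        36 * (β * ε)) := by
        refine mul_le_mul_of_nonneg_left (add_le_add ?_ (by linarith)) (by positivity)
        calc _ = 36 * (c * Real.exp (β * R) / ((n : ℕ) : ℝ)) ^ 2 := by ring
          _ ≤ _ := by linarith
    _ = _ := by ring

theorem klDiv_specsPolicy_le {target draft : Policy X B} {H : ℕ} {r : X → List B → ℝ}
    {rPRM : X → List B → B → ℝ} {β τ R ε : ℝ} {n : ℕ+} (hβ : 0 < β) (hε : 0 ≤ ε) {x : X}
    (hint : ∀ s, s.length ≤ H → Integrable (fun y => Real.exp (β * r x y))
      (law (complete target x (H - s.length) s)))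
    (hR : ∀ s, s.length < H → ∃ a : ℝ, ∀ b, rPRM x s b ∈ Set.Icc a (a + R))
    (hPRM : ∀ s, s.length < H → ∀ b, |rPRM x s b - idealPRM target r β H x s b| ≤ ε)
    {ν : PMF ℕ+} (hν : ν = PMF.pure n ∨ ν = positivePoisson n) :
    klDiv (law (specsPolicy target draft rPRM β τ ν H x)) (optimalPolicy target r β H x) ≤
      ENNReal.ofReal 36 * errorRate H β R ε n (coverage target draft H x) := by
  obtain ⟨S, hS⟩ := exists_optimal_step hβ.ne' hint
  rw [optimalPolicy_eq_law hint fun s hs b => (hS s hs b).2]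
  have hn : (0 : ℝ) < ((n : ℕ) : ℝ) := by exact_mod_cast n.pos
  rcases Nat.eq_zero_or_pos H with rfl | hH
  · refine (klDiv_run_le (η := 0) (γ := 0) le_rfl le_rfl fun s hs => absurd hs (by omega)).trans ?_
    simp
  rcases eq_or_ne (coverage target draft H x) ⊤ with hc | hc
  -- Infinite coverage with `H > 0` makes the right side `⊤`.
  · have h1 : (H : ℝ≥0∞) ≠ 0 := by exact_mod_cast hH.ne'
    have h2 : ENNReal.ofReal (Real.exp (2 * β * R) / ((n : ℕ) : ℝ) ^ (3 / 2 : ℝ)) ≠ 0 :=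
      (ENNReal.ofReal_pos.2 (by positivity)).ne'
    rw [errorRate, hc, ENNReal.top_pow two_ne_zero, ENNReal.mul_top h1, ENNReal.top_mul h2,
      top_add, ENNReal.mul_top (ENNReal.ofReal_pos.2 (by norm_num)).ne']
    exact le_top
  have hcov : ∀ s : List B, s.length < H →
      ratioSup (target x s) (draft x s) * ratioSup (draft x s) (target x s) ≤
        coverage target draft H x := fun s hs =>
    le_iSup₂ (f := fun (s : List B) (_ : s.length < H) =>
      ratioSup (target x s) (draft x s) * ratioSup (draft x s) (target x s)) s hs
  obtain ⟨c, hc0, hcc⟩ : ∃ c : ℝ, 0 ≤ c ∧ coverage target draft H x = ENNReal.ofReal c :=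
    ⟨_, ENNReal.toReal_nonneg, (ENNReal.ofReal_toReal hc).symm⟩
  rw [hcc] at hcov ⊢
  refine (klDiv_run_le (η := 6 * (c * Real.exp (β * R)) / ((n : ℕ) : ℝ)) (γ := 2 * (β * ε))
    (by positivity) (by positivity) fun s hs => ?_).trans
    (mul_ofReal_le_errorRate hc0 hβ.le hε n)
  obtain ⟨Q, hQ, hQS⟩ := exists_tilt hβ.le (fun b => (hS s hs b).1) (hPRM s hs)
  obtain ⟨a, ha⟩ := hR s hs
  refine ⟨Q, fun f => ?_, hQS⟩
  rcases f with _ | _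
  -- With the target as generator the product of ratios is at most one, hence below any coverage
  -- coefficient.
  · refine near_bind_select (G := target x s) hβ.le ha hc0 ?_ hQ hν
    refine le_trans ?_ (hcov s hs)
    exact (mul_le_one' (ratioSup_self_le _) (ratioSup_self_le _)).trans
      (one_le_mul (one_le_ratioSup _ _) (one_le_ratioSup _ _))
  · exact near_bind_select (G := draft x s) hβ.le ha hc0 (hcov s hs) hQ hν

theorem errorRate_mono (H : ℕ) (β R ε : ℝ) (n : ℕ+) {c d : ℝ≥0∞} (h : c ≤ d) :
    errorRate H β R ε n c ≤ errorRate H β R ε n d := by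
  unfold errorRate
  gcongr

end SPECS

theorem mainTheorem5 :
    ∃ (C : ℝ) (k : ℕ), 0 < C ∧
      ∀ (X B : Type*) (target draft : SPECS.Policy X B) (H : ℕ)
        (r : X → List B → ℝ) (rPRM : X → List B → B → ℝ) (β τ R ε : ℝ) (n : ℕ+),
        3 ≤ n → 0 < β → 0 ≤ ε →
        -- the exponential moments in the definition of the value function are finite
        (∀ x s, s.length ≤ H → Integrable (fun y => Real.exp (β * r x y))
          (SPECS.law (SPECS.complete target x (H - s.length) s))) →
        -- the process reward model takes values in a range of length `R`
        (∀ x s, s.length < H → ∃ a : ℝ, ∀ b, rPRM x s b ∈ Set.Icc a (a + R)) →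
        -- it is within `ε` of the idealized one in sup norm
        (∀ x s, s.length < H → ∀ b,
          |rPRM x s b - SPECS.idealPRM target r β H x s b| ≤ ε) →
        -- the beam-width is `n`, or is redrawn from `Poi(n)|_{>0}` in each iteration
        ∀ ν : PMF ℕ+, (ν = PMF.pure n ∨ ν = SPECS.positivePoisson n) →
          (∀ x, klDiv (SPECS.law (SPECS.specsPolicy target draft rPRM β τ ν H x))
              (SPECS.optimalPolicy target r β H x)
            ≤ ENNReal.ofReal (C * Real.log n ^ k) *
              SPECS.errorRate H β R ε n (SPECS.coverage target draft H x)) ∧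
          (∀ ρ : PMF X,
            ∑' x, ρ x * klDiv (SPECS.law (SPECS.specsPolicy target draft rPRM β τ ν H x))
              (SPECS.optimalPolicy target r β H x)
            ≤ ENNReal.ofReal (C * Real.log n ^ k) *
              SPECS.errorRate H β R ε n (⨆ x, SPECS.coverage target draft H x)) := by
  -- `36 = 6 ^ 2` also absorbs the 2 in front of `βε`; no power of the logarithm is needed.
  refine ⟨36, 0, by norm_num, ?_⟩
  intro X B target draft H r rPRM β τ R ε n _ hβ hε hint hR hPRM ν hν
  have key := fun x => SPECS.klDiv_specsPolicy_le (draft := draft) (τ := τ) hβ hε (hint x) (hR x)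
    (hPRM x) hν
  rw [pow_zero, mul_one]
  refine ⟨key, fun ρ => ?_⟩
  calc _ ≤ ∑' x, ρ x * (ENNReal.ofReal 36 *
        SPECS.errorRate H β R ε n (⨆ x, SPECS.coverage target draft H x)) := by
        refine ENNReal.tsum_le_tsum fun x => mul_le_mul_right ((key x).trans ?_) _
        exact mul_le_mul_right (SPECS.errorRate_mono _ _ _ _ _
          (le_iSup (fun x => SPECS.coverage target draft H x) x)) _
    _ = _ := by rw [ENNReal.tsum_mul_right, ρ.tsum_coe, one_mul]
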